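/- **Algorithm A (edge density of a concentrated-degree graph).** Input: a graph $G$ on $n\ge 2$ vertices, $\varepsilon>0$ and $k\ge 0$; $c>0$ is a fixed constant. Let $x_e\in\{0,1\}$ be the indicator of the pair $e$ being an edge, $p_G=\binom n2^{-1}\sum_e x_e$, $\bar d_G=(n-1)p_G$ and $\beta=\min(\varepsilon,1/\sqrt k)$ (with $1/\sqrt0=\infty$). Let $k_G$ be the smallest positive integer such that at most $k_G$ vertices have degree outside $I_G=[\bar d_G-k-3k_G,\ \bar d_G+k+3k_G]$. For a vertex $v$ let $t_v$ be the distance from $\deg_G(v)$ to $I_G$ and $\mathrm{wt}(v)=\max(0,1-\beta t_v)$; for a pair $e=\{u,v\}$ let $\mathrm{wt}(e)=\min(\mathrm{wt}(u),\mathrm{wt}(v))$ and $\mathrm{val}(e)=\mathrm{wt}(e)x_e+(1-\mathrm{wt}(e))p_G$. Let $f(G)=\sum_e\mathrm{val}(e)$ over unordered pairs of distinct vertices, and $$s=\max_{\ell\ge0}\,c\,e^{-\beta\ell}\bigl(k_G+\ell+k+\beta(k_G+\ell)(k_G+\ell+k)+1/\beta\bigr).$$ Return $\binom n2^{-1}\bigl(f(G)+(s/\varepsilon)T\bigr)$,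 where $T$ has Student's $t$-distribution with three degrees of freedom. **Algorithm B (parameter of an Erdős–Rényi graph).** Input: a graph $G$ on $n$ vertices and $\varepsilon,\alpha>0$. Put $\tilde p=p_G+\frac{2}{\varepsilon n}Z+\frac{4\log(1/\alpha)}{\varepsilon n}$ with $Z$ a standard Laplace variable, and $\tilde k=\sqrt{\tilde p\,n\log(n/\alpha)}$ (read as $0$ if $\tilde p<0$). Return $\hat p$, the output of Algorithm A on $G$ with parameters $\varepsilon$ and $k=\tilde k$, with $T$ independent of $Z$. **Theorem.** For every real $M$ there are integers $\gamma\ge1$ and $a\ge0$, and for every constant $c>0$ a constant $C>0$, such that the following holds for all $n\ge2$, $0\le p\le\frac12$ and $\varepsilon>0$ for which either $\varepsilon\le M$, or $p\ge\frac{\log n}{n}$ and $\varepsilon\le n^{M}$. Let $G\sim G(n,p)$ be independent of the noise of the algorithm, and run Algorithm B with $\alpha=n^{-\gamma}$. Then the squared error $(p-\hat p)^2$ is integrable and $$\left|\ \mathbb E\bigl[(p-\hat p)^2\bigr]-\frac{p(1-p)}{\binom n2}\ \right|\ \le\ C\,(\log n)^a\left(\frac{\max\{p,1/n\}}{\varepsilon^2n^3}+\frac1{\varepsilon^4n^4}\right).$$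 -/

import Mathlib

open MeasureTheory ProbabilityTheory
open scoped NNReal ENNReal

namespace NodePrivate

/-- The standard Laplace distribution, with density `exp (-|z|) / 2`. -/
noncomputable def laplaceMeasure : Measure ℝ :=
  volume.withDensity fun z => ENNReal.ofReal (Real.exp (-|z|) / 2)

/-- Student's `t`-distribution with three degrees of freedom, with density
`2 / (π √3 (1 + z ^ 2 / 3) ^ 2)` (mean `0`, variance `3`). -/
noncomputable def studentT3Measure : Measure ℝ :=
  volume.withDensity fun z =>
    ENNReal.ofReal (2 / (Real.pi * √3 * (1 + z ^ 2 / 3) ^ 2))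

section Estimator

variable {n : ℕ}

open Classical in
/-- The indicator `x_e` of the pair `e = {u, v}` being an edge of `G`. -/
noncomputable def edgeInd (G : SimpleGraph (Fin n)) (u v : Fin n) : ℝ :=
  if G.Adj u v then 1 else 0

open Classical in
/-- The degree of `v` in `G`, as a real number. -/
noncomputable def deg (G : SimpleGraph (Fin n)) (v : Fin n) : ℝ :=
  (G.degree v : ℝ)

/-- The empirical edge density `p_G = |E| / (n choose 2)`; the sum runs over the unordered pairs
of distinct vertices, each listed once as `u < v`. -/
noncomputable def edgeDensity (G : SimpleGraph (Fin n)) : ℝ :=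
  (∑ u, ∑ v ∈ Finset.Ioi u, edgeInd G u v) / (n.choose 2 : ℝ)

/-- The empirical average degree `(n - 1) p_G`. -/
noncomputable def avgDeg (G : SimpleGraph (Fin n)) : ℝ :=
  ((n : ℝ) - 1) * edgeDensity G

/-- The vertices whose degree lies outside `[avgDeg - k - 3 j, avgDeg + k + 3 j]`. -/
def farSet (G : SimpleGraph (Fin n)) (k : ℝ) (j : ℕ) : Set (Fin n) :=
  {v | deg G v ∉ Set.Icc (avgDeg G - k - 3 * j) (avgDeg G + k + 3 * j)}

/-- `k_G`: the smallest positive integer `j` such that at most `j` vertices have degree outside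
`[avgDeg - k - 3 j, avgDeg + k + 3 j]`. -/
noncomputable def kG (G : SimpleGraph (Fin n)) (k : ℝ) : ℕ :=
  sInf {j : ℕ | 0 < j ∧ (farSet G k j).ncard ≤ j}

/-- The interval `I_G = [avgDeg - k - 3 k_G, avgDeg + k + 3 k_G]`. -/
noncomputable def degInterval (G : SimpleGraph (Fin n)) (k : ℝ) : Set ℝ :=
  Set.Icc (avgDeg G - k - 3 * kG G k) (avgDeg G + k + 3 * kG G k)

/-- The parameter `β = min (ε, 1 / √k)`, where `1 / √0 = ∞`. -/
noncomputable def betaParam (ε k : ℝ) : ℝ :=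
  if k = 0 then ε else min ε (1 / √k)

/-- The weight `max (0, 1 - β t_v)` of a vertex, where `t_v` is the distance of its degree to the
interval `I_G`. -/
noncomputable def vertexWt (G : SimpleGraph (Fin n)) (ε k : ℝ) (v : Fin n) : ℝ :=
  max 0 (1 - betaParam ε k * Metric.infDist (deg G v) (degInterval G k))

/-- The weight of a pair of vertices. -/
noncomputable def pairWt (G : SimpleGraph (Fin n)) (ε k : ℝ) (u v : Fin n) : ℝ :=
  min (vertexWt G ε k u) (vertexWt G ε k v)

/-- The value of a pair of vertices. -/
noncomputable def pairVal (G : SimpleGraph (Fin n)) (ε k : ℝ) (u v : Fin n) : ℝ :=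
  pairWt G ε k u v * edgeInd G u v + (1 - pairWt G ε k u v) * edgeDensity G

/-- The total value of all unordered pairs of distinct vertices. -/
noncomputable def totalVal (G : SimpleGraph (Fin n)) (ε k : ℝ) : ℝ :=
  ∑ u, ∑ v ∈ Finset.Ioi u, pairVal G ε k u v

/-- The noise scale `s`, a maximum over real `ℓ ≥ 0`; `c` is the constant in the bound on the
local sensitivity of `totalVal`. For `ε > 0` and `k ≥ 0` one has `β > 0`, so the supremum is
attained. -/
noncomputable def noiseScale (c : ℝ) (G : SimpleGraph (Fin n)) (ε k : ℝ) : ℝ :=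
  ⨆ ℓ : ℝ≥0, c * Real.exp (-(betaParam ε k * ℓ)) *
    ((kG G k : ℝ) + ℓ + k
      + betaParam ε k * ((kG G k : ℝ) + ℓ) * ((kG G k : ℝ) + ℓ + k)
      + 1 / betaParam ε k)

/-- The output of the edge density estimator for concentrated-degree graphs with parameters `ε`
and `k ≥ 0`, when its noise variable takes the value `z`. -/
noncomputable def concentratedDegreeEstimator (c : ℝ) (G : SimpleGraph (Fin n))
    (ε k z : ℝ) : ℝ :=
  (totalVal G ε k + noiseScale c G ε k / ε * z) / (n.choose 2 : ℝ)

/-- The noisy overestimate `p̃ = p_G + (2 / (ε n)) z + 4 log (1/α) / (ε n)` of the density. -/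
noncomputable def pTilde (G : SimpleGraph (Fin n)) (ε α z : ℝ) : ℝ :=
  edgeDensity G + 2 / (ε * n) * z + 4 * Real.log (1 / α) / (ε * n)

/-- The concentration parameter `k̃ = √(p̃ n log (n/α))`, equal to `0` if `p̃ < 0`. -/
noncomputable def kTilde (G : SimpleGraph (Fin n)) (ε α z : ℝ) : ℝ :=
  √(pTilde G ε α z * n * Real.log (n / α))

/-- The output of the estimator for the parameter of an Erdős–Rényi graph, when its Laplace noise
takes the value `z.1` and its Student noise takes the value `z.2`. -/
noncomputable def erdosRenyiEstimator (c ε α : ℝ) (G : SimpleGraph (Fin n)) (z : ℝ × ℝ) : ℝ :=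
  concentratedDegreeEstimator c G ε (kTilde G ε α z.1) z.2

end Estimator

/-- The joint law of a graph `G ~ G(n, p)` and of the two noise variables of the algorithm, which
are independent of `G` and of one another. -/
noncomputable def jointLaw (n : ℕ) (p : unitInterval) :
    Measure (SimpleGraph (Fin n) × (ℝ × ℝ)) :=
  (SimpleGraph.binomialRandom (Fin n) p).prod (laplaceMeasure.prod studentT3Measure)

/-- The squared error of the estimator as a function of the graph and the noise. -/
noncomputable def squaredError {n : ℕ} (c ε α : ℝ) (p : unitInterval)
    (ω : SimpleGraph (Fin n) × (ℝ × ℝ)) : ℝ :=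
  ((p : ℝ) - erdosRenyiEstimator c ε α ω.1 ω.2) ^ 2

end NodePrivate

/-! Write `N` for `n.choose 2`, `f` for `totalVal`, `s` for `noiseScale`. The Student noise `T` is
centred, has finite variance and is independent of the rest, so the mean squared error is exactly
`E[(p - f/N)²] + E[T²] E[s²] / (εN)²` (`integrable_and_integral_squaredError`).

With high probability every degree is within `kTilde` of the average degree. Then `kG = 1`, all
weights are `1`, and `f/N` is the empirical density, whose squared error has mean exactly
`p(1-p)/N`. Otherwise both estimates of `p` still lie in `[0,1]`, so the first term differs from
`p(1-p)/N` by at most the probability of failure, of order `n⁻ᴷ` (`abs_integral_sub_variance_le`).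

On the good event `s` is at most a constant times `1 + kTilde + 1/ε`, and `kTilde²` is, up to
logarithms, `n p_G` plus Laplace noise over `ε`; this gives the stated rate. Off the good event `s²`
is at most polynomial in `n`, apart from factors `1 + 1/ε²` and `1 + |z|`, and `K` is chosen so that
`n⁻ᴷ` cancels that power (`noiseScale_sq_le`).

Failure has two sources. Atypical graphs are excluded by Chernoff bounds (`exists_bad_set`). Very
negative Laplace noise is handled by an exponential majorant, `badBound`, which turns the case
distinction into integrals of functions that separate in graph and noise.

The dichotomy on `ε` and `p` keeps `β` bounded: either `ε` itself is bounded, or `p ≥ log n / n`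
forces `kTilde ≥ 1` on the good event, hence `β ≤ 1`. -/

namespace NodePrivate

/-! ### Deterministic bounds on weights, values and the noise scale. -/

section Deterministic

variable {n : ℕ}

theorem farSet_ncard_le (G : SimpleGraph (Fin n)) (k : ℝ) (j : ℕ) : (farSet G k j).ncard ≤ n := by
  simpa using Set.ncard_le_ncard (Set.subset_univ (farSet G k j))

theorem kG_le (hn : 0 < n) (G : SimpleGraph (Fin n)) (k : ℝ) : kG G k ≤ n :=
  Nat.sInf_le ⟨hn, farSet_ncard_le G k n⟩

theorem kG_mem (hn : 0 < n) (G : SimpleGraph (Fin n)) (k : ℝ) :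
    0 < kG G k ∧ (farSet G k (kG G k)).ncard ≤ kG G k :=
  Nat.sInf_mem (s := {j : ℕ | 0 < j ∧ (farSet G k j).ncard ≤ j}) ⟨n, hn, farSet_ncard_le G k n⟩

/-- Widening the interval only removes far vertices. Monotonicity is what makes `kG` measurable in
the random parameter `k`. -/
theorem kG_antitone (hn : 0 < n) (G : SimpleGraph (Fin n)) : Antitone (kG G) := by
  intro k k' h
  obtain ⟨h0, h1⟩ := kG_mem hn G k
  refine Nat.sInf_le ⟨h0, (Set.ncard_le_ncard ?_).trans h1⟩
  rintro v hv ⟨hv1, hv2⟩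
  exact hv ⟨by linarith, by linarith⟩

theorem kG_eq_one {G : SimpleGraph (Fin n)} {k : ℝ} (h : ∀ v, |deg G v - avgDeg G| ≤ k) :
    kG G k = 1 := by
  have h1 : farSet G k 1 = ∅ := by
    ext v
    simp only [farSet, Set.mem_ofPred_eq, Set.mem_empty_iff_false, iff_false, not_not, Set.mem_Icc]
    have := abs_le.1 (h v)
    push_cast
    constructor <;> linarith
  have h2 : kG G k ≤ 1 := Nat.sInf_le ⟨one_pos, by simp [h1]⟩
  have h3 : kG G k ∈ {j : ℕ | 0 < j ∧ (farSet G k j).ncard ≤ j} :=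
    Nat.sInf_mem ⟨1, one_pos, by simp [h1]⟩
  exact le_antisymm h2 h3.1

theorem betaParam_pos {ε k : ℝ} (hε : 0 < ε) (hk : 0 ≤ k) : 0 < betaParam ε k := by
  unfold betaParam
  split_ifs with h
  · exact hε
  · have : 0 < k := lt_of_le_of_ne hk (Ne.symm h)
    positivity

theorem betaParam_le (ε k : ℝ) : betaParam ε k ≤ ε := by
  unfold betaParam
  split_ifs with h
  · exact le_rfl
  · exact min_le_left _ _

theorem betaParam_le_one {ε k : ℝ} (hk : 1 ≤ k) : betaParam ε k ≤ 1 := by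
  rw [betaParam, if_neg (by linarith)]
  refine (min_le_right _ _).trans ?_
  rw [div_le_one (by positivity)]
  exact Real.one_le_sqrt.2 hk

theorem inv_betaParam_le {ε k : ℝ} (hε : 0 < ε) (hk : 0 ≤ k) :
    1 / betaParam ε k ≤ 1 / ε + √k := by
  unfold betaParam
  split_ifs with h
  · have := Real.sqrt_nonneg k
    linarith
  · have hk' : 0 < √k := Real.sqrt_pos.2 (lt_of_le_of_ne hk (Ne.symm h))
    rcases min_choice ε (1 / √k) with h1 | h1 <;> rw [h1]
    · linarith
    · rw [one_div_one_div]
      have : 0 < 1 / ε := by positivity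
      linarith

/-- The cap `1/√k` in `β` serves here: the quadratic term `β K (K + k)` of the noise scale then
costs only `√k` when `K = 1`. -/
theorem betaParam_mul_le {ε k : ℝ} (hk : 0 ≤ k) : betaParam ε k * k ≤ √k := by
  unfold betaParam
  split_ifs with h
  · simp [h]
  · have hk' : 0 < √k := Real.sqrt_pos.2 (lt_of_le_of_ne hk (Ne.symm h))
    calc min ε (1 / √k) * k ≤ 1 / √k * k := by gcongr; exact min_le_right _ _
      _ = √k := by
        rw [one_div, inv_mul_eq_div, div_eq_iff hk'.ne']
        exact (Real.mul_self_sqrt hk).symm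

theorem sqrt_le_one_add {k : ℝ} (hk : 0 ≤ k) : √k ≤ 1 + k := by
  rw [Real.sqrt_le_left (by linarith)]
  nlinarith

theorem vertexWt_nonneg (G : SimpleGraph (Fin n)) (ε k : ℝ) (v : Fin n) : 0 ≤ vertexWt G ε k v :=
  le_max_left _ _

theorem vertexWt_le_one {G : SimpleGraph (Fin n)} {ε k : ℝ} (hε : 0 < ε) (hk : 0 ≤ k)
    (v : Fin n) : vertexWt G ε k v ≤ 1 := by
  refine max_le zero_le_one ?_
  have := mul_nonneg (betaParam_pos hε hk).le
    (Metric.infDist_nonneg (x := deg G v) (s := degInterval G k))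
  linarith

theorem edgeInd_mem (G : SimpleGraph (Fin n)) (u v : Fin n) :
    0 ≤ edgeInd G u v ∧ edgeInd G u v ≤ 1 := by
  unfold edgeInd
  split_ifs <;> norm_num

theorem sum_pairs_const (n : ℕ) (x : ℝ) :
    ∑ u : Fin n, ∑ _v ∈ Finset.Ioi u, x = (n.choose 2 : ℝ) * x := by
  simp only [Finset.sum_const, Fin.card_Ioi, nsmul_eq_mul, ← Finset.sum_mul]
  congr 1
  rw [← Nat.cast_sum, Fin.sum_univ_eq_sum_range (fun i => n - 1 - i) n,
    Finset.sum_range_reflect (fun i => i) n, Finset.sum_range_id, Nat.choose_two_right]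

theorem choose_two_pos (hn : 2 ≤ n) : (0 : ℝ) < n.choose 2 := by
  exact_mod_cast Nat.choose_pos hn

theorem edgeDensity_mem (G : SimpleGraph (Fin n)) :
    0 ≤ edgeDensity G ∧ edgeDensity G ≤ 1 := by
  constructor
  · exact div_nonneg (Finset.sum_nonneg fun u _ => Finset.sum_nonneg fun v _ =>
      (edgeInd_mem G u v).1) (Nat.cast_nonneg _)
  · refine div_le_one_of_le₀ ?_ (Nat.cast_nonneg _)
    calc _ ≤ ∑ u : Fin n, ∑ _v ∈ Finset.Ioi u, (1 : ℝ) :=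
          Finset.sum_le_sum fun u _ => Finset.sum_le_sum fun v _ => (edgeInd_mem G u v).2
      _ = _ := by rw [sum_pairs_const, mul_one]

theorem pairVal_mem (G : SimpleGraph (Fin n)) {ε k : ℝ} (hε : 0 < ε) (hk : 0 ≤ k)
    (u v : Fin n) : 0 ≤ pairVal G ε k u v ∧ pairVal G ε k u v ≤ 1 := by
  have h0 : 0 ≤ pairWt G ε k u v := le_min (vertexWt_nonneg ..) (vertexWt_nonneg ..)
  have h1 : pairWt G ε k u v ≤ 1 := (min_le_left _ _).trans (vertexWt_le_one hε hk u)
  obtain ⟨a0, a1⟩ := edgeInd_mem G u v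
  obtain ⟨b0, b1⟩ := edgeDensity_mem G
  unfold pairVal
  constructor
  · have := mul_nonneg h0 a0
    have := mul_nonneg (sub_nonneg.2 h1) b0
    linarith
  · have := mul_le_mul_of_nonneg_left a1 h0
    have := mul_le_mul_of_nonneg_left b1 (sub_nonneg.2 h1)
    linarith

theorem totalVal_div_mem (G : SimpleGraph (Fin n)) {ε k : ℝ} (hε : 0 < ε) (hk : 0 ≤ k) :
    0 ≤ totalVal G ε k / n.choose 2 ∧ totalVal G ε k / n.choose 2 ≤ 1 := by
  constructor
  · exact div_nonneg (Finset.sum_nonneg fun u _ => Finset.sum_nonneg fun v _ =>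
      (pairVal_mem G hε hk u v).1) (Nat.cast_nonneg _)
  · refine div_le_one_of_le₀ ?_ (Nat.cast_nonneg _)
    calc _ ≤ ∑ u : Fin n, ∑ _v ∈ Finset.Ioi u, (1 : ℝ) :=
          Finset.sum_le_sum fun u _ => Finset.sum_le_sum fun v _ => (pairVal_mem G hε hk u v).2
      _ = _ := by rw [sum_pairs_const, mul_one]

theorem vertexWt_eq_one {G : SimpleGraph (Fin n)} {k : ℝ} (ε : ℝ)
    (h : ∀ v, |deg G v - avgDeg G| ≤ k) (v : Fin n) : vertexWt G ε k v = 1 := by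
  have hv := abs_le.1 (h v)
  have : deg G v ∈ degInterval G k := by
    rw [degInterval, kG_eq_one h]
    push_cast
    constructor <;> linarith
  simp [vertexWt, Metric.infDist_zero_of_mem this]

theorem totalVal_div_eq_edgeDensity {G : SimpleGraph (Fin n)} {k : ℝ} (ε : ℝ)
    (h : ∀ v, |deg G v - avgDeg G| ≤ k) : totalVal G ε k / n.choose 2 = edgeDensity G := by
  unfold totalVal
  rw [edgeDensity]
  congr 1
  refine Finset.sum_congr rfl fun u _ => Finset.sum_congr rfl fun v _ => ?_
  simp [pairVal, pairWt, vertexWt_eq_one ε h]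

theorem mul_exp_neg_le {b : ℝ} (hb : 0 < b) (l : ℝ) : l * Real.exp (-(b * l)) ≤ 1 / b := by
  rw [Real.exp_neg, ← div_eq_mul_inv, div_le_div_iff₀ (Real.exp_pos _) hb]
  have := Real.add_one_le_exp (b * l)
  linarith

theorem mul_sq_exp_neg_le {b l : ℝ} (hb : 0 < b) (hl : 0 ≤ l) :
    b * l ^ 2 * Real.exp (-(b * l)) ≤ 2 / b := by
  rw [Real.exp_neg, ← div_eq_mul_inv, div_le_div_iff₀ (Real.exp_pos _) hb]
  have := Real.quadratic_le_exp_of_nonneg (mul_nonneg hb.le hl)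
  have := mul_nonneg hb.le hl
  nlinarith

/-- Expanding in powers of `l`, the exponential absorbs `l` at cost `1/b` and `b l²` at cost `2/b`,
so the bound is uniform in `l`. -/
theorem noise_term_le {b K k l : ℝ} (hb : 0 < b) (hK : 0 ≤ K) (hk : 0 ≤ k) (hl : 0 ≤ l) :
    Real.exp (-(b * l)) * (K + l + k + b * (K + l) * (K + l + k) + 1 / b)
      ≤ 3 * K + 2 * k + b * K * (K + k) + 4 / b := by
  set E := Real.exp (-(b * l)) with hE
  have hE0 : 0 ≤ E := Real.exp_nonneg _
  have hE1 : E ≤ 1 := Real.exp_le_one_iff.2 (by have := mul_nonneg hb.le hl; linarith)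
  have h1 : l * E ≤ 1 / b := mul_exp_neg_le hb l
  have h2 : b * l ^ 2 * E ≤ 2 / b := mul_sq_exp_neg_le hb hl
  have h3 : E * (K + k + b * K * (K + k) + 1 / b) ≤ K + k + b * K * (K + k) + 1 / b :=
    mul_le_of_le_one_left (by positivity) hE1
  have h4 : (b * (2 * K + k)) * (l * E) ≤ (b * (2 * K + k)) * (1 / b) := by gcongr
  have h5 : (b * (2 * K + k)) * (1 / b) = 2 * K + k := by field_simp
  calc _ = E * (K + k + b * K * (K + k) + 1 / b) + l * E + (b * (2 * K + k)) * (l * E)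
        + b * l ^ 2 * E := by ring
    _ ≤ (K + k + b * K * (K + k) + 1 / b) + 1 / b + (2 * K + k) + 2 / b := by linarith
    _ = _ := by ring

theorem noiseScale_nonneg {c : ℝ} (hc : 0 ≤ c) (G : SimpleGraph (Fin n)) {ε k : ℝ}
    (hε : 0 < ε) (hk : 0 ≤ k) : 0 ≤ noiseScale c G ε k := by
  have := betaParam_pos hε hk
  exact Real.iSup_nonneg fun l => by positivity

theorem noiseScale_le {c : ℝ} (hc : 0 ≤ c) (G : SimpleGraph (Fin n)) {ε k : ℝ}
    (hε : 0 < ε) (hk : 0 ≤ k) : noiseScale c G ε k ≤ c * (3 * kG G k + 2 * k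
      + betaParam ε k * kG G k * (kG G k + k) + 4 / betaParam ε k) := by
  refine ciSup_le fun l => ?_
  rw [mul_assoc]
  gcongr
  exact noise_term_le (betaParam_pos hε hk) (Nat.cast_nonneg _) hk l.2

/-- Bound on the noise scale that needs no concentration. -/
theorem noiseScale_le_of_two_le {c : ℝ} (hc : 0 ≤ c) (hn : 2 ≤ n) (G : SimpleGraph (Fin n))
    {ε k : ℝ} (hε : 0 < ε) (hk : 0 ≤ k) :
    noiseScale c G ε k ≤ c * (8 * (n : ℝ) ^ 2 * (1 + ε) * (1 + k + 1 / ε)) := by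
  refine (noiseScale_le hc G hε hk).trans ?_
  gcongr
  have hb := betaParam_pos hε hk
  have hK : (kG G k : ℝ) ≤ n := by exact_mod_cast kG_le (by omega) G k
  have hn' : (2 : ℝ) ≤ n := by exact_mod_cast hn
  have h1 := inv_betaParam_le hε hk
  have h2 := sqrt_le_one_add hk
  have he : 0 < 1 / ε := by positivity
  have h3 : betaParam ε k * kG G k * (kG G k + k) ≤ ε * n * (n + k) := by
    gcongr
    exact betaParam_le ε k
  have h4 : 4 / betaParam ε k ≤ 4 * (1 / ε + 1 + k) := by
    rw [show 4 / betaParam ε k = 4 * (1 / betaParam ε k) by ring]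
    linarith
  have h5 : ε * n * (n + k) ≤ ε * n ^ 2 * (1 + k) := by
    have : (n : ℝ) + k ≤ n * (1 + k) := by nlinarith
    calc ε * n * (n + k) ≤ ε * n * (n * (1 + k)) := by gcongr
      _ = _ := by ring
  have h6 : (4 : ℝ) ≤ n ^ 2 := by nlinarith
  have h7 : (n : ℝ) * 2 ≤ n ^ 2 := by nlinarith
  have h8 : 4 * (1 + k + 1 / ε) ≤ (n : ℝ) ^ 2 * (1 + k + 1 / ε) := by gcongr
  have h9 : 4 * k ≤ (n : ℝ) ^ 2 * k := by gcongr
  have h10 : 0 ≤ (n : ℝ) ^ 2 * (1 / ε) := by positivity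
  have h11 : 0 ≤ ε * (n : ℝ) ^ 2 * (1 + k) := by positivity
  have h12 : 0 ≤ ε * (n : ℝ) ^ 2 * (1 / ε) := by positivity
  nlinarith

/-- Bound on the noise scale for a graph whose degrees are concentrated. -/
theorem noiseScale_le_of_concentrated {c m : ℝ} (hc : 0 ≤ c) (hm : 1 ≤ m)
    {G : SimpleGraph (Fin n)} {ε k : ℝ} (hε : 0 < ε) (hk : 0 ≤ k)
    (h : ∀ v, |deg G v - avgDeg G| ≤ k) (hβ : betaParam ε k ≤ m) :
    noiseScale c G ε k ≤ c * (8 * m * (1 + k + 1 / ε)) := by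
  refine (noiseScale_le hc G hε hk).trans ?_
  rw [kG_eq_one h]
  gcongr
  have h1 := inv_betaParam_le hε hk
  have h2 := sqrt_le_one_add hk
  have h3 := betaParam_mul_le (ε := ε) hk
  have he : 0 < 1 / ε := by positivity
  have h4 : 4 / betaParam ε k = 4 * (1 / betaParam ε k) := by ring
  have h5 : 1 * (1 + k + 1 / ε) ≤ m * (1 + k + 1 / ε) := by gcongr
  push_cast
  rw [h4]
  nlinarith


end Deterministic
-- Measurability in the graph and the noise.
section Measurability

variable {n : ℕ}

instance : MeasurableSingletonClass (SimpleGraph (Fin n)) where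
  measurableSet_singleton G := by
    have h := (measurableSet_singleton (G.edgeSet)).preimage
      (SimpleGraph.measurableEmbedding_edgeSet (V := Fin n)).measurable
    convert h
    ext H
    simp

theorem measurable_kG (hn : 0 < n) (G : SimpleGraph (Fin n)) : Measurable (kG G) :=
  (kG_antitone hn G).measurable

theorem measurable_betaParam (ε : ℝ) : Measurable (betaParam ε) := by
  unfold betaParam
  exact Measurable.ite (measurableSet_singleton 0) measurable_const (by fun_prop)

theorem measurable_noiseScale (hn : 0 < n) (c : ℝ) (G : SimpleGraph (Fin n)) (ε : ℝ) :
    Measurable (noiseScale c G ε) := by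
  -- The terms are continuous in `ℓ`, so the uncountable supremum can be taken over a countable
  -- dense set.
  obtain ⟨S, hSc, hSd⟩ := TopologicalSpace.exists_countable_dense ℝ≥0
  have hS : Countable S := hSc.to_subtype
  have h : noiseScale c G ε = fun k => ⨆ l : S, c * Real.exp (-(betaParam ε k * (l : ℝ≥0))) *
      ((kG G k : ℝ) + (l : ℝ≥0) + k
        + betaParam ε k * ((kG G k : ℝ) + (l : ℝ≥0)) * ((kG G k : ℝ) + (l : ℝ≥0) + k)
        + 1 / betaParam ε k) := by
    ext k
    exact (hSd.ciSup' (f := fun l : ℝ≥0 => c * Real.exp (-(betaParam ε k * l)) *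
      ((kG G k : ℝ) + l + k + betaParam ε k * ((kG G k : ℝ) + l) * ((kG G k : ℝ) + l + k)
        + 1 / betaParam ε k)) (by fun_prop)).symm
  rw [h]
  have h1 := measurable_betaParam ε
  have h2 : Measurable fun k => (kG G k : ℝ) := measurable_from_top.comp (measurable_kG hn G)
  exact Measurable.iSup fun l => by fun_prop

/-- The distance to a growing set decreases. Truncating the radius at `0` keeps the interval
nonempty; `Metric.infDist` to the empty set is `0`, which would break monotonicity. -/
theorem measurable_infDist_Icc (x a : ℝ) :
    Measurable fun r : ℝ => Metric.infDist x (Set.Icc (a - max r 0) (a + max r 0)) := by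
  refine Antitone.measurable fun r r' h => ?_
  have h' : max r 0 ≤ max r' 0 := max_le_max_right 0 h
  refine Metric.infDist_le_infDist_of_subset (Set.Icc_subset_Icc (by linarith) (by linarith)) ?_
  have := le_max_right r 0
  exact ⟨a, by linarith, by linarith⟩

theorem measurable_vertexWt_comp (hn : 0 < n) (G : SimpleGraph (Fin n)) (ε : ℝ) (v : Fin n)
    {g : ℝ → ℝ} (hg : Measurable g) (hg0 : ∀ z, 0 ≤ g z) :
    Measurable fun z => vertexWt G ε (g z) v := by
  have h2 : Measurable fun z => (kG G (g z) : ℝ) :=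
    measurable_from_top.comp ((measurable_kG hn G).comp hg)
  have h3 : ∀ z, Metric.infDist (deg G v) (degInterval G (g z)) =
      Metric.infDist (deg G v) (Set.Icc (avgDeg G - max (g z + 3 * kG G (g z)) 0)
        (avgDeg G + max (g z + 3 * kG G (g z)) 0)) := by
    intro z
    have := hg0 z
    rw [max_eq_left (by positivity), degInterval, sub_sub, add_assoc]
  unfold vertexWt
  simp_rw [h3]
  have h4 := (measurable_infDist_Icc (deg G v) (avgDeg G)).comp
    (hg.add (h2.const_mul 3))
  exact measurable_const.max
    (measurable_const.sub (((measurable_betaParam ε).comp hg).mul h4))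

theorem measurable_totalVal_comp (hn : 0 < n) (G : SimpleGraph (Fin n)) (ε : ℝ)
    {g : ℝ → ℝ} (hg : Measurable g) (hg0 : ∀ z, 0 ≤ g z) :
    Measurable fun z => totalVal G ε (g z) := by
  unfold totalVal pairVal pairWt
  have := fun v => measurable_vertexWt_comp hn G ε v hg hg0
  fun_prop

theorem kTilde_nonneg (G : SimpleGraph (Fin n)) (ε α z : ℝ) : 0 ≤ kTilde G ε α z :=
  Real.sqrt_nonneg _

theorem measurable_kTilde (G : SimpleGraph (Fin n)) (ε α : ℝ) : Measurable (kTilde G ε α) := by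
  unfold kTilde pTilde
  fun_prop

theorem measurable_totalVal_kTilde (hn : 0 < n) (ε α : ℝ) :
    Measurable fun x : SimpleGraph (Fin n) × ℝ => totalVal x.1 ε (kTilde x.1 ε α x.2) :=
  measurable_from_prod_countable_right fun G =>
    measurable_totalVal_comp hn G ε (measurable_kTilde G ε α) (kTilde_nonneg G ε α)

theorem measurable_noiseScale_kTilde (hn : 0 < n) (c ε α : ℝ) :
    Measurable fun x : SimpleGraph (Fin n) × ℝ => noiseScale c x.1 ε (kTilde x.1 ε α x.2) :=
  measurable_from_prod_countable_right fun G =>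
    (measurable_noiseScale hn c G ε).comp (measurable_kTilde G ε α)

end Measurability
-- Moments of the Laplace and Student distributions.
section Noise

theorem integral_exp_neg_mul_abs {b : ℝ} (hb : 0 < b) :
    ∫ z : ℝ, Real.exp (-(b * |z|)) = 2 / b := by
  have h := integral_comp_abs (f := fun z : ℝ => Real.exp (-b * z))
  simp only [neg_mul] at h
  rw [h]
  have h2 := integral_exp_mul_Ioi (neg_neg_of_pos hb) 0
  simp only [neg_mul] at h2
  rw [h2]
  simp [neg_div, div_neg]
  ring

theorem integrable_exp_neg_mul_abs {b : ℝ} (hb : 0 < b) :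
    Integrable fun z : ℝ => Real.exp (-(b * |z|)) := by
  -- A non-integrable function has integral `0` by convention, contradicting the positive value
  -- already computed.
  by_contra h
  have h1 := integral_exp_neg_mul_abs hb
  rw [integral_undef h] at h1
  have : 0 < 2 / b := by positivity
  linarith

theorem isProbabilityMeasure_withDensity_ofReal {f : ℝ → ℝ} (hf : Integrable f)
    (h0 : ∀ x, 0 ≤ f x) (h1 : ∫ x, f x = 1) :
    IsProbabilityMeasure (volume.withDensity fun x => ENNReal.ofReal (f x)) := by
  constructor
  rw [withDensity_apply _ MeasurableSet.univ, Measure.restrict_univ,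
    ← ofReal_integral_eq_lintegral_ofReal hf (Filter.Eventually.of_forall h0), h1,
    ENNReal.ofReal_one]

theorem integrable_withDensity_ofReal {f g : ℝ → ℝ} (hf : Measurable f)
    (h0 : ∀ x, 0 ≤ f x) :
    Integrable g (volume.withDensity fun x => ENNReal.ofReal (f x)) ↔
      Integrable fun x => f x * g x := by
  rw [integrable_withDensity_iff_integrable_smul' hf.ennreal_ofReal
    (Filter.Eventually.of_forall fun _ => ENNReal.ofReal_lt_top)]
  simp only [ENNReal.toReal_ofReal (h0 _), smul_eq_mul]

theorem integral_withDensity_ofReal {f g : ℝ → ℝ} (hf : Measurable f)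
    (h0 : ∀ x, 0 ≤ f x) :
    ∫ x, g x ∂(volume.withDensity fun x => ENNReal.ofReal (f x)) = ∫ x, f x * g x := by
  rw [integral_withDensity_eq_integral_toReal_smul hf.ennreal_ofReal
    (Filter.Eventually.of_forall fun _ => ENNReal.ofReal_lt_top)]
  simp only [ENNReal.toReal_ofReal (h0 _), smul_eq_mul]

instance : IsProbabilityMeasure laplaceMeasure := by
  have h := integral_exp_neg_mul_abs one_pos
  have h2 := integrable_exp_neg_mul_abs one_pos
  simp only [one_mul] at h h2
  exact isProbabilityMeasure_withDensity_ofReal (h2.div_const 2) (fun z => by positivity)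
    (by rw [integral_div, h]; norm_num)

theorem integrable_exp_abs_laplaceMeasure {b : ℝ} (hb : b < 1) :
    Integrable (fun z => Real.exp (b * |z|)) laplaceMeasure := by
  rw [laplaceMeasure, integrable_withDensity_ofReal (by fun_prop) (fun z => by positivity)]
  have h := (integrable_exp_neg_mul_abs (sub_pos.2 hb)).div_const 2
  refine h.congr (Filter.Eventually.of_forall fun z => ?_)
  simp only
  rw [div_mul_eq_mul_div, ← Real.exp_add]
  ring_nf

/-- The density of Student's `t`-distribution with three degrees of freedom. -/
noncomputable def studentDensity (z : ℝ) : ℝ := 2 / (Real.pi * √3 * (1 + z ^ 2 / 3) ^ 2)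

theorem measurable_studentDensity : Measurable studentDensity := by
  unfold studentDensity
  fun_prop

theorem studentDensity_nonneg (z : ℝ) : 0 ≤ studentDensity z := by
  unfold studentDensity
  positivity

theorem studentDensity_mul_le (z : ℝ) :
    studentDensity z * (1 + z ^ 2 / 3) ≤ (1 + (z / √3) ^ 2)⁻¹ := by
  have h3 : (z / √3) ^ 2 = z ^ 2 / 3 := by rw [div_pow, Real.sq_sqrt (by norm_num)]
  rw [h3, studentDensity]
  have hp : 2 ≤ Real.pi * √3 := by
    have := Real.pi_gt_three
    have : 1 ≤ √3 := Real.one_le_sqrt.2 (by norm_num)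
    nlinarith
  have hz : 0 < 1 + z ^ 2 / 3 := by positivity
  rw [div_mul_eq_mul_div, div_le_iff₀ (by positivity)]
  have : (1 + z ^ 2 / 3)⁻¹ * (Real.pi * √3 * (1 + z ^ 2 / 3) ^ 2)
      = Real.pi * √3 * (1 + z ^ 2 / 3) := by field_simp
  rw [this]
  gcongr

/-- Quadratic growth uses up one of the two factors `1 + z²/3` in the denominator; the other leaves
an integrable Cauchy majorant. -/
theorem integrable_studentDensity_mul {g : ℝ → ℝ} (hg : Measurable g)
    (h : ∀ z, |g z| ≤ 3 * (1 + z ^ 2 / 3)) : Integrable fun z => studentDensity z * g z := by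
  refine Integrable.mono' ((integrable_inv_one_add_sq.comp_div (g := fun x : ℝ => (1 + x ^ 2)⁻¹)
    (R := √3) (by positivity)).const_mul 3)
    (measurable_studentDensity.mul hg).aestronglyMeasurable
    (Filter.Eventually.of_forall fun z => ?_)
  rw [Real.norm_eq_abs, abs_mul, abs_of_nonneg (studentDensity_nonneg z)]
  calc _ ≤ studentDensity z * (3 * (1 + z ^ 2 / 3)) :=
        mul_le_mul_of_nonneg_left (h z) (studentDensity_nonneg z)
    _ = 3 * (studentDensity z * (1 + z ^ 2 / 3)) := by ring
    _ ≤ _ := by gcongr; exact studentDensity_mul_le z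

theorem integral_two_div_one_add_sq_sq : ∫ x : ℝ, 2 / (1 + x ^ 2) ^ 2 = Real.pi := by
  -- Explicit antiderivative; only the arctangent contributes at infinity.
  have hd : ∀ x : ℝ, HasDerivAt (fun x : ℝ => x / (1 + x ^ 2) + Real.arctan x)
      (2 / (1 + x ^ 2) ^ 2) x := by
    intro x
    have hx : 1 + x ^ 2 ≠ 0 := by positivity
    have h1 : HasDerivAt (fun x : ℝ => 1 + x ^ 2) (2 * x) x := by
      simpa using (hasDerivAt_pow 2 x).const_add 1
    refine (((hasDerivAt_id x).div h1 hx).add (Real.hasDerivAt_arctan x)).congr_deriv ?_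
    simp only [id]
    field_simp
    ring
  have hi : Integrable fun x : ℝ => 2 / (1 + x ^ 2) ^ 2 := by
    refine Integrable.mono' (integrable_inv_one_add_sq.const_mul 2)
      (by fun_prop : Measurable _).aestronglyMeasurable (Filter.Eventually.of_forall fun x => ?_)
    rw [Real.norm_eq_abs, abs_of_nonneg (by positivity), div_eq_mul_inv]
    gcongr
    nlinarith [sq_nonneg x]
  have ht : Filter.Tendsto (fun x : ℝ => x / (1 + x ^ 2)) Filter.atTop (nhds 0) := by
    refine squeeze_zero' (Filter.eventually_ge_atTop 0 |>.mono fun x hx => by positivity)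
      (Filter.eventually_gt_atTop 0 |>.mono fun x hx => ?_) tendsto_inv_atTop_zero
    rw [div_le_iff₀ (by positivity), inv_mul_eq_div, le_div_iff₀ hx]
    nlinarith
  have hb : Filter.Tendsto (fun x : ℝ => x / (1 + x ^ 2)) Filter.atBot (nhds 0) := by
    have := (ht.comp Filter.tendsto_neg_atBot_atTop).neg
    simpa [Function.comp_def, neg_div] using this
  have h := integral_of_hasDerivAt_of_tendsto hd hi
    (hb.add (Real.tendsto_arctan_atBot.mono_right nhdsWithin_le_nhds))
    (ht.add (Real.tendsto_arctan_atTop.mono_right nhdsWithin_le_nhds))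
  rw [h]
  ring

theorem integral_studentDensity : ∫ z, studentDensity z = 1 := by
  have h : studentDensity = fun z => (Real.pi * √3)⁻¹ * (2 / (1 + (z / √3) ^ 2) ^ 2) := by
    ext z
    have h3 : (z / √3) ^ 2 = z ^ 2 / 3 := by rw [div_pow, Real.sq_sqrt (by norm_num)]
    rw [h3, studentDensity]
    field_simp
  rw [h, integral_const_mul, Measure.integral_comp_div (fun x : ℝ => 2 / (1 + x ^ 2) ^ 2),
    integral_two_div_one_add_sq_sq, smul_eq_mul, abs_of_nonneg (Real.sqrt_nonneg 3)]
  have := Real.pi_pos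
  field_simp

theorem integrable_studentT3Measure_iff {g : ℝ → ℝ} :
    Integrable g studentT3Measure ↔ Integrable fun z => studentDensity z * g z :=
  integrable_withDensity_ofReal measurable_studentDensity studentDensity_nonneg

instance : IsProbabilityMeasure studentT3Measure := by
  refine isProbabilityMeasure_withDensity_ofReal (f := studentDensity) ?_ studentDensity_nonneg
    integral_studentDensity
  by_contra h
  have := integral_studentDensity
  rw [integral_undef h] at this
  norm_num at this

theorem integrable_id_studentT3Measure : Integrable (fun z : ℝ => z) studentT3Measure := by
  rw [integrable_studentT3Measure_iff]
  refine integrable_studentDensity_mul measurable_id fun z => ?_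
  rw [abs_le]
  constructor <;> nlinarith [sq_nonneg (z - 1), sq_nonneg (z + 1)]

theorem integrable_sq_studentT3Measure : Integrable (fun z : ℝ => z ^ 2) studentT3Measure := by
  rw [integrable_studentT3Measure_iff]
  refine integrable_studentDensity_mul (by fun_prop) fun z => ?_
  rw [abs_of_nonneg (sq_nonneg z)]
  linarith

theorem integral_id_studentT3Measure : ∫ z, z ∂studentT3Measure = 0 := by
  have h : ∫ z, z ∂studentT3Measure = ∫ z, studentDensity z * z :=
    integral_withDensity_ofReal measurable_studentDensity studentDensity_nonneg
  have h2 := integral_neg_eq_self (fun z : ℝ => studentDensity z * z) volume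
  have h3 : ∀ z, studentDensity (-z) = studentDensity z := fun z => by simp [studentDensity]
  simp only [h3, mul_neg, integral_neg] at h2
  rw [h]
  linarith

end Noise
-- Independent edges: variance of the density and Chernoff bounds.
section RandomGraph

variable {n : ℕ}

/-- The unordered pairs of distinct vertices. -/
def pairs (n : ℕ) : Finset (Sym2 (Fin n)) := Finset.univ.filter fun e => ¬ e.IsDiag

open Classical in
/-- The indicator of an unordered pair being an edge. -/
noncomputable def edgeVar (G : SimpleGraph (Fin n)) (e : Sym2 (Fin n)) : ℝ :=
  if e ∈ G.edgeSet then 1 else 0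

theorem mem_pairs {e : Sym2 (Fin n)} : e ∈ pairs n ↔ ¬ e.IsDiag := by simp [pairs]

theorem card_pairs : (pairs n).card = n.choose 2 := by
  have := Sym2.card_subtype_not_diag (α := Fin n)
  rw [Fintype.card_subtype, Fintype.card_fin] at this
  exact this

theorem sum_edgeInd_eq (G : SimpleGraph (Fin n)) :
    ∑ u, ∑ v ∈ Finset.Ioi u, edgeInd G u v = ∑ e ∈ pairs n, edgeVar G e := by
  have h := Finset.sum_sym2_filter_not_isDiag (Finset.univ : Finset (Fin n)) (edgeVar G)
  rw [Finset.sym2_univ] at h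
  rw [pairs, h, Finset.sum_sigma']
  refine Finset.sum_bij' (fun x _ => (x.1, x.2)) (fun x _ => ⟨x.1, x.2⟩) ?_ ?_ ?_ ?_ ?_
  · rintro ⟨u, v⟩ h
    simp only [Finset.mem_sigma, Finset.mem_Ioi] at h
    simp [h.2, h.2.ne]
  · rintro ⟨u, v⟩ h
    simpa using (Finset.mem_filter.1 h).2
  · intros; rfl
  · intros; rfl
  · rintro ⟨u, v⟩ h
    simp only [edgeInd, edgeVar, SimpleGraph.mem_edgeSet]
    congr

/-- The pairs that contain a given vertex. -/
def incidentPairs (v : Fin n) : Finset (Sym2 (Fin n)) := (pairs n).filter fun e => v ∈ e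

open Classical in
theorem deg_eq_sum (G : SimpleGraph (Fin n)) (v : Fin n) :
    deg G v = ∑ e ∈ incidentPairs v, edgeVar G e := by
  rw [deg, ← G.card_incidenceFinset_eq_degree, SimpleGraph.incidenceFinset_eq_filter]
  simp only [edgeVar]
  rw [Finset.sum_boole]
  congr 2
  ext e
  simp only [incidentPairs, Finset.mem_filter, mem_pairs, SimpleGraph.mem_edgeFinset]
  constructor
  · rintro ⟨h1, h2⟩
    exact ⟨⟨G.not_isDiag_of_mem_edgeSet h1, h2⟩, h1⟩
  · rintro ⟨⟨_, h2⟩, h1⟩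
    exact ⟨h1, h2⟩

open Classical in
theorem card_incidentPairs (v : Fin n) : (incidentPairs v).card = n - 1 := by
  have h := (⊤ : SimpleGraph (Fin n)).card_incidenceFinset_eq_degree v
  rw [SimpleGraph.complete_graph_degree, Fintype.card_fin,
    SimpleGraph.incidenceFinset_eq_filter] at h
  rw [← h]
  congr 1
  ext e
  simp [incidentPairs, mem_pairs]

open Classical in
theorem sum_deg (G : SimpleGraph (Fin n)) :
    ∑ v, deg G v = 2 * ∑ e ∈ pairs n, edgeVar G e := by
  have h := G.sum_degrees_eq_twice_card_edges
  simp only [deg]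
  rw [← Nat.cast_sum, h]
  simp only [edgeVar]
  rw [Finset.sum_boole]
  push_cast
  congr 3
  ext e
  simp only [mem_pairs, Finset.mem_filter, SimpleGraph.mem_edgeFinset]
  exact ⟨fun h => ⟨G.not_isDiag_of_mem_edgeSet h, h⟩, fun h => h.2⟩

theorem edgeDensity_eq (G : SimpleGraph (Fin n)) :
    edgeDensity G = (∑ e ∈ pairs n, edgeVar G e) / n.choose 2 := by
  rw [edgeDensity, sum_edgeInd_eq]

theorem choose_two_eq (n : ℕ) : (n.choose 2 : ℝ) = n * (n - 1) / 2 := Nat.cast_choose_two ℝ n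

theorem avgDeg_eq (hn : 2 ≤ n) (G : SimpleGraph (Fin n)) :
    avgDeg G = (∑ v, deg G v) / n := by
  have hn' : (2 : ℝ) ≤ n := by exact_mod_cast hn
  have h1 : (n : ℝ) - 1 ≠ 0 := by linarith
  have h2 : (n : ℝ) ≠ 0 := by linarith
  rw [avgDeg, edgeDensity_eq, sum_deg, choose_two_eq]
  field_simp

/-- Expectations of products of functions of distinct edge indicators factorize. -/
theorem integral_prod_edgeVar (p : unitInterval) {T : Finset (Sym2 (Fin n))} (hT : T ⊆ pairs n)
    (h : Sym2 (Fin n) → ℝ → ℝ) :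
    ∫ G, ∏ e ∈ T, h e (edgeVar G e) ∂(SimpleGraph.binomialRandom (Fin n) p)
      = ∏ e ∈ T, ((p : ℝ) * h e 1 + (1 - p) * h e 0) := by
  classical
  rw [SimpleGraph.binomialRandom_eq_map, integral_map
    SimpleGraph.measurable_fromEdgeSet.aemeasurable
    (measurable_of_finite _).aestronglyMeasurable, setBernoulli_eq_map]
  have hm : Measurable fun p : Sym2 (Fin n) → Prop => {i | p i} :=
    MeasurableEquiv.setOfPred.measurable
  have hf : Measurable fun S : Set (Sym2 (Fin n)) =>
      ∏ e ∈ T, h e (edgeVar (SimpleGraph.fromEdgeSet S) e) :=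
    (measurable_of_finite fun G => ∏ e ∈ T, h e (edgeVar G e)).comp
      SimpleGraph.measurable_fromEdgeSet
  rw [integral_map hm.aemeasurable hf.aestronglyMeasurable, Measure.infinitePi_eq_pi]
  have h1 : ∀ ω : Sym2 (Fin n) → Prop,
      ∏ e ∈ T, h e (edgeVar (SimpleGraph.fromEdgeSet {i | ω i}) e)
        = ∏ e, if e ∈ T then h e (if ω e then 1 else 0) else 1 := by
    intro ω
    rw [Finset.prod_ite_mem, Finset.univ_inter]
    refine Finset.prod_congr rfl fun e he => ?_
    have := mem_pairs.1 (hT he)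
    simp [edgeVar, this]
  simp_rw [h1]
  rw [integral_fintype_prod_eq_prod (fun e (b : Prop) => if e ∈ T then h e (if b then 1 else 0) else 1)]
  rw [← Finset.univ_inter T, ← Finset.prod_ite_mem]
  refine Finset.prod_congr rfl fun e _ => ?_
  rw [Finset.univ_inter]
  split_ifs with he
  · have := mem_pairs.1 (hT he)
    rw [integral_add_measure, integral_smul_nnreal_measure, integral_smul_nnreal_measure]
    · simp [this, NNReal.smul_def]
    · exact Integrable.of_finite
    · exact Integrable.of_finite
  · simp

theorem integral_edgeVar (p : unitInterval) {e : Sym2 (Fin n)} (he : e ∈ pairs n) :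
    ∫ G, edgeVar G e ∂(SimpleGraph.binomialRandom (Fin n) p) = p := by
  have h := integral_prod_edgeVar p (Finset.singleton_subset_iff.2 he) fun _ x => x
  simpa using h

theorem integral_centered_mul (p : unitInterval) {e f : Sym2 (Fin n)} (he : e ∈ pairs n)
    (hf : f ∈ pairs n) :
    ∫ G, (edgeVar G e - p) * (edgeVar G f - p) ∂(SimpleGraph.binomialRandom (Fin n) p)
      = if e = f then (p : ℝ) * (1 - p) else 0 := by
  split_ifs with hef
  · subst hef
    have h := integral_prod_edgeVar p (Finset.singleton_subset_iff.2 he)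
      fun _ x => (x - p) * (x - p)
    simp only [Finset.prod_singleton] at h
    rw [h]
    ring
  · have h := integral_prod_edgeVar p (T := {e, f})
      (Finset.insert_subset he (Finset.singleton_subset_iff.2 hf)) fun _ x => x - p
    simp only [Finset.prod_pair hef] at h
    rw [h]
    ring

theorem integral_edgeDensity (hn : 2 ≤ n) (p : unitInterval) :
    ∫ G, edgeDensity G ∂(SimpleGraph.binomialRandom (Fin n) p) = p := by
  simp_rw [edgeDensity_eq (n := n)]
  rw [integral_div, integral_finsetSum _ fun _ _ => Integrable.of_finite,
    Finset.sum_congr rfl fun e he => integral_edgeVar p he, Finset.sum_const, card_pairs,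
    nsmul_eq_mul, mul_div_cancel_left₀ _ (choose_two_pos hn).ne']

/-- The variance of the empirical edge density. -/
theorem integral_sq_sub_edgeDensity (hn : 2 ≤ n) (p : unitInterval) :
    ∫ G, ((p : ℝ) - edgeDensity G) ^ 2 ∂(SimpleGraph.binomialRandom (Fin n) p)
      = p * (1 - p) / n.choose 2 := by
  have hN := choose_two_pos hn
  have h : ∀ G : SimpleGraph (Fin n), ((p : ℝ) - edgeDensity G) ^ 2 =
      (∑ e ∈ pairs n, ∑ f ∈ pairs n, (edgeVar G e - p) * (edgeVar G f - p))
        / (n.choose 2 : ℝ) ^ 2 := by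
    intro G
    rw [← Finset.sum_mul_sum, Finset.sum_sub_distrib, Finset.sum_const, card_pairs,
      nsmul_eq_mul, edgeDensity_eq]
    field_simp
    ring
  simp_rw [h]
  rw [integral_div, integral_finsetSum _ fun _ _ => Integrable.of_finite,
    Finset.sum_congr rfl fun e he => (integral_finsetSum _ fun _ _ => Integrable.of_finite).trans
      (Finset.sum_congr rfl fun f hf => integral_centered_mul p he hf)]
  rw [Finset.sum_congr rfl fun e he => (Finset.sum_ite_eq (pairs n) e fun _ => (p : ℝ) * (1 - p)).trans
    (if_pos he), Finset.sum_const, card_pairs, nsmul_eq_mul]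
  field_simp

/-- By independence it suffices to treat one edge, where `1 + x ≤ exp x` and `exp t - 1 - t ≤ t²`
for `|t| ≤ 1` give the factor `exp (p t²)`. -/
theorem integral_exp_centered_le (p : unitInterval) {T : Finset (Sym2 (Fin n))}
    (hT : T ⊆ pairs n) {t : ℝ} (ht : |t| ≤ 1) :
    ∫ G, Real.exp (t * (∑ e ∈ T, edgeVar G e - T.card * p))
        ∂(SimpleGraph.binomialRandom (Fin n) p) ≤ Real.exp (T.card * p * t ^ 2) := by
  have h1 : ∀ G : SimpleGraph (Fin n), Real.exp (t * (∑ e ∈ T, edgeVar G e - T.card * p))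
      = ∏ e ∈ T, Real.exp (t * (edgeVar G e - p)) := by
    intro G
    rw [← Real.exp_sum, ← Finset.mul_sum, Finset.sum_sub_distrib, Finset.sum_const, nsmul_eq_mul]
  simp_rw [h1]
  rw [integral_prod_edgeVar p hT fun _ x => Real.exp (t * (x - p)), Finset.prod_const,
    mul_assoc, Real.exp_nat_mul]
  have hp0 := p.2.1
  have hp1 := p.2.2
  have h2 : (p : ℝ) * Real.exp (t * (1 - p)) + (1 - p) * Real.exp (t * (0 - p))
      = (1 + p * (Real.exp t - 1)) * Real.exp (-(p * t)) := by
    rw [show t * (1 - (p : ℝ)) = t + -(p * t) by ring,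
      show t * (0 - (p : ℝ)) = -(p * t) by ring, Real.exp_add]
    ring
  have h3 := abs_le.1 (Real.abs_exp_sub_one_sub_id_le ht)
  gcongr
  rw [h2]
  calc _ ≤ Real.exp (p * (Real.exp t - 1)) * Real.exp (-(p * t)) := by
        gcongr
        linarith [Real.add_one_le_exp ((p : ℝ) * (Real.exp t - 1))]
    _ = Real.exp (p * (Real.exp t - 1 - t)) := by rw [← Real.exp_add]; ring_nf
    _ ≤ _ := by gcongr; exact h3.2

/-- Chernoff bound for the number of edges among a set of pairs; the sign of `t` selects the
tail. -/
theorem measureReal_le_exp (p : unitInterval) {T : Finset (Sym2 (Fin n))}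
    (hT : T ⊆ pairs n) {t : ℝ} (ht : |t| ≤ 1) (x : ℝ) :
    (SimpleGraph.binomialRandom (Fin n) p).real
        {G | x ≤ t * (∑ e ∈ T, edgeVar G e - T.card * p)}
      ≤ Real.exp (T.card * p * t ^ 2 - x) := by
  have h := measure_ge_le_exp_mul_mgf (μ := SimpleGraph.binomialRandom (Fin n) p)
    (X := fun G => t * (∑ e ∈ T, edgeVar G e - T.card * p)) (t := 1) x zero_le_one
    Integrable.of_finite
  refine h.trans ?_
  rw [mgf, sub_eq_add_neg, add_comm, Real.exp_add]
  simp only [neg_mul, one_mul]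
  gcongr
  exact integral_exp_centered_le p hT ht

end RandomGraph
-- Atypical graphs are rare, and the others are concentrated.
section BadSet

variable {n : ℕ}

theorem exp_neg_mul_log (hn : 2 ≤ n) (K : ℕ) :
    Real.exp (-(K * Real.log n)) = ((n : ℝ) ^ K)⁻¹ := by
  have : (0 : ℝ) < n := by positivity
  rw [Real.exp_neg, Real.exp_nat_mul, Real.exp_log this]

/-- Graphs with an atypical vertex degree or with too few edges. -/
def atypical (n : ℕ) (p : unitInterval) (K : ℕ) (r : ℝ) : Set (SimpleGraph (Fin n)) :=
  (⋃ v, {G | r ≤ |deg G v - (n - 1) * p|}) ∪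
    {G | (∑ e ∈ pairs n, edgeVar G e) ≤ n.choose 2 * p / 2 - 4 * K * Real.log n}

theorem incidentPairs_subset (v : Fin n) : incidentPairs v ⊆ pairs n := Finset.filter_subset _ _

theorem measureReal_deg_le (hn : 2 ≤ n) (p : unitInterval) {K : ℕ} (hK : 0 < K) {q : ℝ}
    (hq1 : (n : ℝ) * p ≤ q) (hq2 : K * Real.log n ≤ q) (v : Fin n) :
    (SimpleGraph.binomialRandom (Fin n) p).real
        {G | 2 * √(K * Real.log n * q) ≤ |deg G v - (n - 1) * p|} ≤ 2 * ((n : ℝ) ^ K)⁻¹ := by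
  have hn' : (2 : ℝ) ≤ n := by exact_mod_cast hn
  have hL : 0 < Real.log n := Real.log_pos (by linarith)
  have hK' : (0 : ℝ) < K := by exact_mod_cast hK
  have hKL : 0 < K * Real.log n := by positivity
  have hq : 0 < q := hKL.trans_le hq2
  -- With this `t` the variance term `n p t²` is at most `K log n`, while the threshold contributes
  -- `2 K log n`; the net exponent is `-K log n`. The condition `K log n ≤ q` ensures `t ≤ 1`.
  set t := √(K * Real.log n / q) with ht
  have ht0 : 0 ≤ t := Real.sqrt_nonneg _
  have ht1 : t ≤ 1 := Real.sqrt_le_one.2 ((div_le_one hq).2 hq2)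
  have hts : t ^ 2 * q = K * Real.log n := by
    rw [ht, Real.sq_sqrt (by positivity)]
    field_simp
  have htr : t * √(K * Real.log n * q) = K * Real.log n := by
    rw [ht, ← Real.sqrt_mul (by positivity), show K * Real.log n / q * (K * Real.log n * q)
      = (K * Real.log n) ^ 2 by field_simp, Real.sqrt_sq hKL.le]
  have hcard : ((incidentPairs v).card : ℝ) = n - 1 := by
    rw [card_incidentPairs, Nat.cast_sub (by omega)]
    simp
  have hm : (n - 1 : ℝ) * p * t ^ 2 ≤ K * Real.log n := by
    rw [← hts, mul_comm (t ^ 2)]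
    have := p.2.1
    refine mul_le_mul_of_nonneg_right ?_ (sq_nonneg t)
    linarith
  have hbound : ∀ s : ℝ, |s| ≤ 1 → s ^ 2 = t ^ 2 →
      (SimpleGraph.binomialRandom (Fin n) p).real
        {G | 2 * (K * Real.log n) ≤ s * (∑ e ∈ incidentPairs v, edgeVar G e - (incidentPairs v).card * p)}
      ≤ ((n : ℝ) ^ K)⁻¹ := by
    intro s hs hst
    refine (measureReal_le_exp p (incidentPairs_subset v) hs _).trans ?_
    rw [← exp_neg_mul_log hn, hcard, hst]
    gcongr
    linarith
  have h1 := hbound t (by rwa [abs_of_nonneg ht0]) rfl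
  have h2 := hbound (-t) (by rwa [abs_neg, abs_of_nonneg ht0]) (neg_sq t)
  calc _ ≤ (SimpleGraph.binomialRandom (Fin n) p).real
        ({G | 2 * (K * Real.log n) ≤ t * (∑ e ∈ incidentPairs v, edgeVar G e - (incidentPairs v).card * p)} ∪
        {G | 2 * (K * Real.log n) ≤ -t * (∑ e ∈ incidentPairs v, edgeVar G e - (incidentPairs v).card * p)}) := by
        refine measureReal_mono fun G hG => ?_
        rw [Set.mem_ofPred_eq, deg_eq_sum, ← hcard] at hG
        have h3 := mul_le_mul_of_nonneg_left hG ht0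
        rw [show t * (2 * √(K * Real.log n * q)) = 2 * (t * √(K * Real.log n * q)) by ring,
          htr] at h3
        rcases abs_choice (∑ e ∈ incidentPairs v, edgeVar G e - (incidentPairs v).card * (p : ℝ)) with h4 | h4 <;>
          rw [h4] at h3
        · exact Or.inl h3
        · right
          rw [Set.mem_ofPred_eq]
          linarith
    _ ≤ _ := measureReal_union_le _ _
    _ ≤ _ := by linarith

theorem measureReal_few_edges_le (hn : 2 ≤ n) (p : unitInterval) (K : ℕ) :
    (SimpleGraph.binomialRandom (Fin n) p).real
        {G | (∑ e ∈ pairs n, edgeVar G e) ≤ n.choose 2 * p / 2 - 4 * K * Real.log n}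
      ≤ ((n : ℝ) ^ K)⁻¹ := by
  -- At `t = -1/4` the variance term `N p / 16` is beaten by the `N p / 8` in the threshold.
  have h := measureReal_le_exp p (Finset.Subset.refl (pairs n)) (t := -1 / 4)
    (by norm_num [abs_div]) (n.choose 2 * p / 8 + K * Real.log n)
  rw [card_pairs] at h
  refine (measureReal_mono fun G hG => ?_).trans (h.trans ?_)
  · rw [Set.mem_ofPred_eq] at hG ⊢
    linarith
  · rw [← exp_neg_mul_log hn]
    gcongr
    have := mul_nonneg (Nat.cast_nonneg (α := ℝ) (n.choose 2)) p.2.1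
    linarith

/-- The exponent `K + 1` pays for the union bound over `n` vertices. -/
theorem measureReal_atypical_le (hn : 2 ≤ n) (p : unitInterval) {K : ℕ} {q : ℝ}
    (hq1 : (n : ℝ) * p ≤ q) (hq2 : (K + 1 : ℕ) * Real.log n ≤ q) :
    (SimpleGraph.binomialRandom (Fin n) p).real
        (atypical n p (K + 1) (2 * √((K + 1 : ℕ) * Real.log n * q))) ≤ 3 * ((n : ℝ) ^ K)⁻¹ := by
  have hn' : (2 : ℝ) ≤ n := by exact_mod_cast hn
  refine (measureReal_union_le _ _).trans ?_
  have h1 := (measureReal_iUnion_fintype_le (μ := SimpleGraph.binomialRandom (Fin n) p) fun v : Fin n =>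
    {G | 2 * √((K + 1 : ℕ) * Real.log n * q) ≤ |deg G v - (n - 1) * p|}).trans
    (Finset.sum_le_sum fun v _ => measureReal_deg_le hn p (Nat.add_one_pos K) hq1 hq2 v)
  have h2 := measureReal_few_edges_le hn p (K + 1)
  rw [Finset.sum_const, Finset.card_univ, Fintype.card_fin, nsmul_eq_mul] at h1
  refine (add_le_add h1 h2).trans ?_
  have h3 : ((n : ℝ) ^ (K + 1))⁻¹ * n = ((n : ℝ) ^ K)⁻¹ := by
    rw [pow_succ]; field_simp
  rw [← h3]
  have h4 : 0 ≤ ((n : ℝ) ^ (K + 1))⁻¹ := by positivity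
  nlinarith

theorem abs_deg_sub_avgDeg_le (hn : 2 ≤ n) {G : SimpleGraph (Fin n)} {d r : ℝ}
    (h : ∀ v, |deg G v - d| ≤ r) (v : Fin n) : |deg G v - avgDeg G| ≤ 2 * r := by
  have hn' : (0 : ℝ) < n := by positivity
  have h1 : |avgDeg G - d| ≤ r := by
    have : avgDeg G - d = (∑ v, (deg G v - d)) / n := by
      rw [avgDeg_eq hn, Finset.sum_sub_distrib, Finset.sum_const, Finset.card_univ,
        Fintype.card_fin, nsmul_eq_mul]
      field_simp
    rw [this, abs_div, abs_of_pos hn', div_le_iff₀ hn']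
    refine (Finset.abs_sum_le_sum_abs _ _).trans ((Finset.sum_le_sum fun v _ => h v).trans ?_)
    rw [Finset.sum_const, Finset.card_univ, Fintype.card_fin, nsmul_eq_mul, mul_comm]
  have h2 := h v
  rw [abs_le] at *
  constructor <;> linarith

/-- Degree deviations are controlled by the unknown `p`, but the algorithm only sees the empirical
density. The lower tail of the edge count bounds `n p` by `edgeDensity G * n` up to a logarithmic
deficit, which is covered by the shift `2γ log n / ε` if `ε ≤ m`, and by `n p` itself if `p ≥ log n
/ n`. -/
theorem exists_bad_set {m : ℕ} (hm : 0 < m) (K : ℕ) {γ : ℕ} (hγ : γ = 64 * m * (K + 1) ^ 2) :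
    ∃ C : ℝ, 0 < C ∧ ∀ (n : ℕ) (p : unitInterval) (ε : ℝ), 2 ≤ n → 0 < ε →
      (ε ≤ m ∨ Real.log n / n ≤ p) → ∃ B : Set (SimpleGraph (Fin n)),
        (SimpleGraph.binomialRandom (Fin n) p).real B ≤ C * ((n : ℝ) ^ K)⁻¹ ∧
        ∀ G ∉ B, (ε ≤ m ∨ 1 ≤ edgeDensity G * n * ((γ + 1) * Real.log n)) ∧
          ∀ v, |deg G v - avgDeg G| ^ 2 ≤
            (edgeDensity G * n + 2 * γ * Real.log n / ε) * ((γ + 1) * Real.log n) := by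
  set J : ℝ := ((K + 1 : ℕ) : ℝ) with hJ
  have hJ1 : 1 ≤ J := by rw [hJ]; exact_mod_cast Nat.succ_pos K
  have hm1 : (1 : ℝ) ≤ m := by exact_mod_cast hm
  have hγ' : (γ : ℝ) = 64 * m * J ^ 2 := by rw [hγ, hJ]; push_cast; ring
  have hγJ : 64 * J ^ 2 ≤ γ := by rw [hγ']; nlinarith [sq_nonneg J]
  refine ⟨3 + (32 * J + 1) ^ K, by positivity, fun n p ε hn hε h => ?_⟩
  have hn' : (2 : ℝ) ≤ n := by exact_mod_cast hn
  have hL : 0 < Real.log n := Real.log_pos (by linarith)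
  have hL1 : 0.69 ≤ Real.log n := by
    have := Real.log_le_log two_pos hn'
    have := Real.log_two_gt_d9
    linarith
  have hnK : (0 : ℝ) < (n : ℝ) ^ K := by positivity
  -- For bounded `n` every graph may be declared bad, at the price of a larger constant.
  by_cases hsmall : (n : ℝ) < 32 * J + 1
  · refine ⟨Set.univ, ?_, fun G hG => absurd (Set.mem_univ G) hG⟩
    rw [probReal_univ, ← div_eq_mul_inv, le_div_iff₀ hnK, one_mul]
    have := pow_le_pow_left₀ (by positivity) hsmall.le K
    linarith
  have hp0 : 0 ≤ (n : ℝ) * p := mul_nonneg (by positivity) p.2.1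
  set q := max ((n : ℝ) * p) (J * Real.log n) with hq
  refine ⟨atypical n p (K + 1) (2 * √(J * Real.log n * q)), ?_, fun G hG => ?_⟩
  · refine (measureReal_atypical_le hn p (le_max_left _ _) (le_max_right _ _)).trans ?_
    gcongr
    have : 0 ≤ (32 * J + 1) ^ K := by positivity
    linarith
  simp only [atypical, Set.mem_union, Set.mem_iUnion, Set.mem_ofPred_eq, not_or, not_exists,
    not_le] at hG
  obtain ⟨hdeg, hedge⟩ := hG
  have hq0 : 0 < q := lt_max_of_lt_right (by positivity)
  have hdeg' : ∀ v, |deg G v - avgDeg G| ^ 2 ≤ 16 * J * q * Real.log n := by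
    intro v
    have h1 := abs_deg_sub_avgDeg_le hn (fun v => (hdeg v).le) v
    calc |deg G v - avgDeg G| ^ 2 ≤ (2 * (2 * √(J * Real.log n * q))) ^ 2 := by gcongr
      _ = 16 * (√(J * Real.log n * q)) ^ 2 := by ring
      _ = _ := by rw [Real.sq_sqrt (by positivity)]; ring
  have hpG : (n : ℝ) * p / 2 - 8 * J * Real.log n / (n - 1) ≤ edgeDensity G * n := by
    have h1 : (n : ℝ) - 1 ≠ 0 := by linarith
    have h2 : edgeDensity G * n = (∑ e ∈ pairs n, edgeVar G e) * (2 / (n - 1)) := by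
      rw [edgeDensity_eq, choose_two_eq]
      field_simp
    have h3 : (0 : ℝ) < 2 / (n - 1) := div_pos two_pos (by linarith)
    have h4 := mul_le_mul_of_nonneg_right hedge.le h3.le
    rw [h2]
    refine le_trans (le_of_eq ?_) h4
    rw [choose_two_eq]
    field_simp
    ring
  have key : (ε ≤ m ∨ 1 ≤ edgeDensity G * n * ((γ + 1) * Real.log n)) ∧
      16 * J * q ≤ (edgeDensity G * n + 2 * γ * Real.log n / ε) * (γ + 1) := by
    have hγL : 0 ≤ 2 * γ * Real.log n / ε := by positivity
    by_cases hεm : ε ≤ m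
    · refine ⟨Or.inl hεm, ?_⟩
      have h1 : 8 * J * Real.log n / (n - 1) ≤ 8 * J * Real.log n :=
        div_le_self (by positivity) (by linarith)
      -- The factor `m` in `γ` offsets `ε ≤ m`. Half of the `16 J log n` repairs the deficit in the
      -- edge count, the other half covers the `J log n` in `q`.
      have h2 : 16 * J * Real.log n ≤ 2 * γ * Real.log n / ε := by
        rw [le_div_iff₀ hε, hγ']
        calc 16 * J * Real.log n * ε ≤ 16 * J * Real.log n * m := by gcongr
          _ ≤ 128 * J ^ 2 * Real.log n * m := by
            have : 16 * J ≤ 128 * J ^ 2 := by nlinarith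
            gcongr
          _ = _ := by ring
      have h3 : q ≤ n * p + J * Real.log n :=
        max_le (by have : 0 < J * Real.log n := by positivity
                   linarith) (by linarith)
      calc 16 * J * q ≤ 16 * J * (n * p + J * Real.log n) := by gcongr
        _ ≤ (n * p / 2 + 8 * J * Real.log n) * (32 * J) := by
          have : 0 ≤ J * (J * Real.log n) := by positivity
          nlinarith
        _ ≤ _ := by
          exact mul_le_mul (by linarith) (by nlinarith) (by positivity) (by linarith)
    · have hp := h.resolve_left hεm
      have hp' : Real.log n ≤ n * p := by
        rw [div_le_iff₀ (by positivity)] at hp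
        linarith
      -- This is where `n ≥ 32 J + 1` is needed.
      have h1 : 8 * J * Real.log n / (n - 1) ≤ Real.log n / 4 := by
        rw [div_le_iff₀ (by linarith)]
        nlinarith
      have h2 : (n : ℝ) * p / 4 ≤ edgeDensity G * n := by linarith
      have h3 : q ≤ J * (n * p) := max_le (by nlinarith) (by gcongr)
      constructor
      · right
        calc (1 : ℝ) ≤ 0.69 / 4 * (64 * 0.69) := by norm_num
          _ ≤ n * p / 4 * ((γ + 1) * Real.log n) := by
            have : (64 : ℝ) ≤ γ + 1 := by nlinarith
            gcongr
            linarith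
          _ ≤ _ := by gcongr
      · calc 16 * J * q ≤ 16 * J * (J * (n * p)) := by gcongr
          _ = (n * p / 4 + 0) * (64 * J ^ 2) := by ring
          _ ≤ _ := mul_le_mul (by linarith) (by linarith) (by positivity) (by linarith)
  refine ⟨key.1, fun v => (hdeg' v).trans ?_⟩
  calc 16 * J * q * Real.log n
      ≤ (edgeDensity G * n + 2 * γ * Real.log n / ε) * (γ + 1) * Real.log n :=
        mul_le_mul_of_nonneg_right key.2 hL.le
    _ = _ := by ring

end BadSet
-- Pointwise majorants for the error and the noise scale.
section Pointwise

variable {n : ℕ}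

theorem log_one_div_one_div_pow (n γ : ℕ) :
    Real.log (1 / (1 / (n : ℝ) ^ γ)) = γ * Real.log n := by
  rw [one_div_one_div, Real.log_pow]

theorem log_div_one_div_pow (n γ : ℕ) :
    Real.log (n / (1 / (n : ℝ) ^ γ)) = (γ + 1) * Real.log n := by
  rw [div_div_eq_mul_div, div_one, ← pow_succ', Real.log_pow]
  push_cast
  rfl

theorem kTilde_eq (hn : 2 ≤ n) (G : SimpleGraph (Fin n)) {ε : ℝ} (hε : 0 < ε) (γ : ℕ) (z : ℝ) :
    kTilde G ε (1 / (n : ℝ) ^ γ) z = √((edgeDensity G * n + (2 * z + 4 * γ * Real.log n) / ε)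
      * ((γ + 1) * Real.log n)) := by
  have hn' : (n : ℝ) ≠ 0 := by positivity
  rw [kTilde, pTilde, log_one_div_one_div_pow, log_div_one_div_pow]
  congr 2
  field_simp
  ring

theorem log_ge_of_two_le (hn : 2 ≤ n) : 0.69 ≤ Real.log n := by
  have := Real.log_le_log two_pos (show (2 : ℝ) ≤ n by exact_mod_cast hn)
  have := Real.log_two_gt_d9
  linarith

theorem one_add_kTilde_sq_le (hn : 2 ≤ n) (G : SimpleGraph (Fin n)) {ε : ℝ} (hε : 0 < ε)
    (γ : ℕ) (z : ℝ) :
    1 + kTilde G ε (1 / (n : ℝ) ^ γ) z ^ 2 + 1 / ε ^ 2 ≤ 7 * (γ + 1) ^ 2 * Real.log n ^ 2 *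
      (edgeDensity G * n + (1 + 1 / ε ^ 2) * (1 + |z|)) := by
  have hL := log_ge_of_two_le hn
  set L := Real.log n
  have hp : 0 ≤ edgeDensity G * n := mul_nonneg (edgeDensity_mem G).1 (Nat.cast_nonneg _)
  have hz := abs_nonneg z
  have hk : kTilde G ε (1 / (n : ℝ) ^ γ) z ^ 2
      ≤ (edgeDensity G * n + (2 * |z| + 4 * γ * L) / ε) * ((γ + 1) * L) := by
    rw [kTilde_eq hn G hε, Real.sq_sqrt']
    refine max_le ?_ (by positivity)
    gcongr
    exact le_abs_self z
  have hε1 : 1 / ε ≤ 1 + 1 / ε ^ 2 := by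
    have := sq_nonneg (1 / ε - 1)
    have h2 : (1 / ε) ^ 2 = 1 / ε ^ 2 := by rw [div_pow, one_pow]
    nlinarith
  set E := 1 + 1 / ε ^ 2
  have hE : 0 ≤ E := by positivity
  have hL2 : L ≤ 2 * L ^ 2 := by nlinarith
  have hL3 : 1 ≤ 3 * L ^ 2 := by nlinarith
  have h1 : (2 * |z| + 4 * γ * L) / ε * ((γ + 1) * L)
      ≤ E * (1 + |z|) * (4 * (γ + 1) ^ 2 * L ^ 2) := by
    have h2 : (2 * |z| + 4 * γ * L) * ((γ + 1) * L)
        ≤ (1 + |z|) * (4 * (γ + 1) ^ 2 * L ^ 2) := by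
      have h3 : 2 * |z| * ((γ + 1) * L) ≤ 2 * |z| * ((γ + 1) * (2 * L ^ 2)) := by gcongr
      have h4 : 0 ≤ |z| * γ * ((γ : ℝ) + 1) * L ^ 2 := by positivity
      have h5 : 0 ≤ ((γ : ℝ) + 1) * L ^ 2 := by positivity
      nlinarith
    calc _ = 1 / ε * ((2 * |z| + 4 * γ * L) * ((γ + 1) * L)) := by ring
      _ ≤ E * ((1 + |z|) * (4 * (γ + 1) ^ 2 * L ^ 2)) := by gcongr
      _ = _ := by ring
  have hγ : (1 : ℝ) ≤ γ + 1 := by have := Nat.cast_nonneg (α := ℝ) γ; linarith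
  have hγ2 : (γ : ℝ) + 1 ≤ (γ + 1) ^ 2 := by nlinarith
  have h6 : edgeDensity G * n * ((γ + 1) * L)
      ≤ edgeDensity G * n * ((γ + 1) ^ 2 * (2 * L ^ 2)) := by gcongr
  have h7 : E * 1 * 1 ≤ E * (1 + |z|) * (3 * (γ + 1) ^ 2 * L ^ 2) := by
    have : 1 ≤ 3 * ((γ : ℝ) + 1) ^ 2 * L ^ 2 := by
      calc 1 ≤ 3 * L ^ 2 * 1 := by linarith
        _ ≤ 3 * L ^ 2 * ((γ : ℝ) + 1) ^ 2 := by gcongr; linarith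
        _ = _ := by ring
    gcongr
    linarith
  have h8 : 0 ≤ edgeDensity G * n * ((γ + 1) ^ 2 * L ^ 2) := by positivity
  calc _ = E * 1 * 1 + kTilde G ε (1 / (n : ℝ) ^ γ) z ^ 2 := by ring
    _ ≤ E * (1 + |z|) * (3 * (γ + 1) ^ 2 * L ^ 2)
        + (edgeDensity G * n + (2 * |z| + 4 * γ * L) / ε) * ((γ + 1) * L) := add_le_add h7 hk
    _ ≤ _ := by linarith

/-- The property of a graph that holds with high probability and makes the estimator exact up to
its Student noise. -/
def Concentrated (G : SimpleGraph (Fin n)) (ε : ℝ) (m γ : ℕ) : Prop :=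
  (ε ≤ m ∨ 1 ≤ edgeDensity G * n * ((γ + 1) * Real.log n)) ∧
    ∀ v, |deg G v - avgDeg G| ^ 2 ≤
      (edgeDensity G * n + 2 * γ * Real.log n / ε) * ((γ + 1) * Real.log n)

/-- The shift in `pTilde` contributes `4γ log n / ε`; Laplace noise above `-γ log n` destroys at
most half of it, and the remaining `2γ log n / ε` is what `Concentrated` asks for. -/
theorem Concentrated.le_kTilde (hn : 2 ≤ n) {G : SimpleGraph (Fin n)} {ε : ℝ} {m γ : ℕ} {z : ℝ}
    (hε : 0 < ε) (hm : 0 < m) (h : Concentrated G ε m γ) (hz : -(γ * Real.log n) ≤ z) :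
    betaParam ε (kTilde G ε (1 / (n : ℝ) ^ γ) z) ≤ m ∧
      ∀ v, |deg G v - avgDeg G| ≤ kTilde G ε (1 / (n : ℝ) ^ γ) z := by
  have hL := log_ge_of_two_le hn
  have h1 : √((edgeDensity G * n + 2 * γ * Real.log n / ε) * ((γ + 1) * Real.log n))
      ≤ kTilde G ε (1 / (n : ℝ) ^ γ) z := by
    rw [kTilde_eq hn G hε]
    gcongr
    linarith
  have hm' : (1 : ℝ) ≤ m := by exact_mod_cast hm
  refine ⟨?_, fun v => (Real.le_sqrt_of_sq_le (h.2 v)).trans h1⟩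
  rcases h.1 with h2 | h2
  · exact (betaParam_le _ _).trans h2
  · refine (betaParam_le_one (le_trans ?_ h1)).trans hm'
    rw [Real.one_le_sqrt]
    refine h2.trans ?_
    gcongr
    have : 0 ≤ 2 * γ * Real.log n / ε := by positivity
    linarith

open Classical in
/-- An upper bound for the indicator of the event that the graph is in `B` or the Laplace noise
is very negative. -/
noncomputable def badBound (B : Set (SimpleGraph (Fin n))) (K : ℕ) (G : SimpleGraph (Fin n))
    (z : ℝ) : ℝ :=
  B.indicator 1 G + ((n : ℝ) ^ K)⁻¹ * Real.exp (|z| / 2)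

theorem badBound_nonneg (B : Set (SimpleGraph (Fin n))) (K : ℕ) (G : SimpleGraph (Fin n))
    (z : ℝ) : 0 ≤ badBound B K G z := by
  have : 0 ≤ B.indicator (1 : SimpleGraph (Fin n) → ℝ) G :=
    Set.indicator_nonneg (fun _ _ => zero_le_one) G
  unfold badBound
  positivity

/-- If `z < -γ log n` with `γ ≥ 2K`, then `exp (|z|/2) ≥ nᴷ`, as in an exponential Markov
inequality. -/
theorem one_le_badBound (hn : 2 ≤ n) {B : Set (SimpleGraph (Fin n))} {K γ : ℕ} (hγ : 2 * K ≤ γ)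
    {G : SimpleGraph (Fin n)} {z : ℝ} (h : ¬ (G ∉ B ∧ -(γ * Real.log n) ≤ z)) :
    1 ≤ badBound B K G z := by
  unfold badBound
  by_cases hG : G ∈ B
  · rw [Set.indicator_of_mem hG, Pi.one_apply]
    have : 0 ≤ ((n : ℝ) ^ K)⁻¹ * Real.exp (|z| / 2) := by positivity
    linarith
  · rw [Set.indicator_of_notMem hG, zero_add, ← exp_neg_mul_log hn, ← Real.exp_add]
    refine Real.one_le_exp ?_
    have hz : z < -(γ * Real.log n) := not_le.1 fun hz => h ⟨hG, hz⟩
    have hL := log_ge_of_two_le hn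
    have h1 := neg_abs_le z
    have h2 : ((2 * K : ℕ) : ℝ) * Real.log n ≤ γ * Real.log n := by
      gcongr
    push_cast at h2
    linarith

theorem abs_sq_sub_sq_le_badBound (hn : 2 ≤ n) {B : Set (SimpleGraph (Fin n))} {K m γ : ℕ}
    (hm : 0 < m) (hγ : 2 * K ≤ γ) {ε : ℝ} (hε : 0 < ε) (hB : ∀ G ∉ B, Concentrated G ε m γ)
    (p : unitInterval) (G : SimpleGraph (Fin n)) (z : ℝ) :
    |((p : ℝ) - totalVal G ε (kTilde G ε (1 / (n : ℝ) ^ γ) z) / n.choose 2) ^ 2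
      - ((p : ℝ) - edgeDensity G) ^ 2| ≤ badBound B K G z := by
  by_cases h : G ∉ B ∧ -(γ * Real.log n) ≤ z
  · rw [totalVal_div_eq_edgeDensity ε ((hB G h.1).le_kTilde hn hε hm h.2).2, sub_self, abs_zero]
    exact badBound_nonneg ..
  · refine le_trans ?_ (one_le_badBound hn hγ h)
    obtain ⟨h1, h2⟩ := totalVal_div_mem G hε (kTilde_nonneg G ε (1 / (n : ℝ) ^ γ) z)
    obtain ⟨h3, h4⟩ := edgeDensity_mem G
    have h5 := p.2.1
    have h6 := p.2.2
    rw [abs_le]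
    constructor <;> nlinarith

theorem sq_one_add_add_le (k x : ℝ) : (1 + k + x) ^ 2 ≤ 3 * (1 + k ^ 2 + x ^ 2) := by
  nlinarith [sq_nonneg (k - 1), sq_nonneg (x - 1), sq_nonneg (k - x)]

/-- A single majorant valid on and off the good event, affine in the density and otherwise a product
of graph and noise factors. The weight `nᴷ` on the indicator of `B` is harmless since `B` has
probability of order `n⁻ᴷ`, and the exponent `3/4 < 1` keeps the Laplace moment finite. -/
theorem noiseScale_sq_le (hn : 2 ≤ n) {B : Set (SimpleGraph (Fin n))} {K m γ : ℕ} (hm : 0 < m)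
    (hK : K = 2 * m + 5) (hγ : 2 * K ≤ γ) {c ε : ℝ} (hc : 0 < c) (hε : 0 < ε)
    (hεm : ε ≤ m * (n : ℝ) ^ m)
    (hB : ∀ G ∉ B, Concentrated G ε m γ) (G : SimpleGraph (Fin n)) (z : ℝ) :
    noiseScale c G ε (kTilde G ε (1 / (n : ℝ) ^ γ) z) ^ 2 ≤
      10752 * c ^ 2 * m ^ 2 * (γ + 1) ^ 2 * Real.log n ^ 2 * (edgeDensity G * n
        + (1 + 1 / ε ^ 2) * ((2 + (n : ℝ) ^ K * B.indicator 1 G)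
          * (4 * Real.exp (3 / 4 * |z|)))) := by
  have hn' : (2 : ℝ) ≤ n := by exact_mod_cast hn
  have hm' : (1 : ℝ) ≤ m := by exact_mod_cast hm
  have hQ := one_add_kTilde_sq_le hn G hε γ z
  have hk := kTilde_nonneg G ε (1 / (n : ℝ) ^ γ) z
  have hs0 := noiseScale_nonneg hc.le G hε hk
  set k := kTilde G ε (1 / (n : ℝ) ^ γ) z
  set s := noiseScale c G ε k
  set E := 1 + 1 / ε ^ 2 with hE
  set L := Real.log n
  have hE1 : 1 ≤ E := by have : 0 < 1 / ε ^ 2 := by positivity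
                         linarith
  have hpG := edgeDensity_mem G
  have hind : 0 ≤ B.indicator (1 : SimpleGraph (Fin n) → ℝ) G :=
    Set.indicator_nonneg (fun _ _ => zero_le_one) G
  have hpos : 0 ≤ edgeDensity G * n := mul_nonneg hpG.1 (Nat.cast_nonneg _)
  have h3 := sq_one_add_add_le k (1 / ε)
  rw [div_pow, one_pow] at h3
  have hexp : 1 + |z| ≤ 4 * Real.exp (|z| / 4) := by
    have := Real.add_one_le_exp (|z| / 4)
    have := abs_nonneg z
    linarith
  have hexp1 : 1 + |z| ≤ 4 * Real.exp (3 / 4 * |z|) := by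
    refine hexp.trans ?_
    gcongr
    have := abs_nonneg z
    linarith
  have hexp2 : (1 + |z|) * Real.exp (|z| / 2) ≤ 4 * Real.exp (3 / 4 * |z|) := by
    calc (1 + |z|) * Real.exp (|z| / 2) ≤ 4 * Real.exp (|z| / 4) * Real.exp (|z| / 2) := by gcongr
      _ = _ := by rw [mul_assoc, ← Real.exp_add]; ring_nf
  set W := 4 * Real.exp (3 / 4 * |z|)
  have hW : 0 ≤ W := by positivity
  have hbd : (n : ℝ) ^ K * (1 + |z|) * badBound B K G z ≤ (1 + (n : ℝ) ^ K * B.indicator 1 G) * W := by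
    have : (n : ℝ) ^ K * (1 + |z|) * badBound B K G z
        = (n : ℝ) ^ K * B.indicator 1 G * (1 + |z|) + (1 + |z|) * Real.exp (|z| / 2) := by
      unfold badBound
      field_simp
    rw [this]
    have : (n : ℝ) ^ K * B.indicator 1 G * (1 + |z|) ≤ (n : ℝ) ^ K * B.indicator 1 G * W := by
      gcongr
    linarith
  have hD : 0 ≤ c ^ 2 * m ^ 2 * ((γ : ℝ) + 1) ^ 2 * L ^ 2 := by positivity
  by_cases h : G ∉ B ∧ -(γ * Real.log n) ≤ z
  · obtain ⟨hβ, hdeg⟩ := (hB G h.1).le_kTilde hn hε hm h.2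
    have h1 := noiseScale_le_of_concentrated hc.le hm' hε hk hdeg hβ
    calc s ^ 2 ≤ (c * (8 * m * (1 + k + 1 / ε))) ^ 2 := by gcongr
      _ = 64 * c ^ 2 * m ^ 2 * (1 + k + 1 / ε) ^ 2 := by ring
      _ ≤ 64 * c ^ 2 * m ^ 2 * (3 * (7 * (γ + 1) ^ 2 * L ^ 2 *
          (edgeDensity G * n + E * (1 + |z|)))) := by
        gcongr
        exact h3.trans (by gcongr)
      _ = 1344 * (c ^ 2 * m ^ 2 * (γ + 1) ^ 2 * L ^ 2) *
          (edgeDensity G * n + E * (1 * (1 + |z|))) := by ring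
      _ ≤ 10752 * (c ^ 2 * m ^ 2 * (γ + 1) ^ 2 * L ^ 2) * (edgeDensity G * n
        + E * ((2 + (n : ℝ) ^ K * B.indicator 1 G) * W)) := by
        have : (1 : ℝ) ≤ 2 + (n : ℝ) ^ K * B.indicator 1 G := by
          have : 0 ≤ (n : ℝ) ^ K * B.indicator 1 G := by positivity
          linarith
        gcongr
        norm_num
      _ = _ := by ring
  · have hb := one_le_badBound hn hγ h
    have h1 := noiseScale_le_of_two_le hc.le hn G hε hk
    have hε1 : 1 + ε ≤ 2 * (m * (n : ℝ) ^ m) := by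
      have : (1 : ℝ) ≤ (n : ℝ) ^ m := one_le_pow₀ (by linarith)
      nlinarith
    have hpG1 : edgeDensity G * n + E * (1 + |z|) ≤ n * (2 * (E * (1 + |z|))) := by
      have h4 : 1 ≤ E * (1 + |z|) := one_le_mul_of_one_le_of_one_le hE1 (by linarith [abs_nonneg z])
      have h5 : edgeDensity G * n ≤ 1 * n := by gcongr; exact hpG.2
      have h6 : 1 * (E * (1 + |z|)) ≤ n * (E * (1 + |z|)) := by gcongr; linarith
      have h7 : (n : ℝ) * 1 ≤ n * (E * (1 + |z|)) := by gcongr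
      linarith
    calc s ^ 2 ≤ (c * (8 * (n : ℝ) ^ 2 * (1 + ε) * (1 + k + 1 / ε))) ^ 2 := by gcongr
      _ ≤ (c * (8 * (n : ℝ) ^ 2 * (2 * (m * (n : ℝ) ^ m)) * (1 + k + 1 / ε))) ^ 2 := by gcongr
      _ = 256 * c ^ 2 * m ^ 2 * (n : ℝ) ^ (2 * m + 4) * (1 + k + 1 / ε) ^ 2 := by ring
      _ ≤ 256 * c ^ 2 * m ^ 2 * (n : ℝ) ^ (2 * m + 4) * (3 * (7 * (γ + 1) ^ 2 * L ^ 2 *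
          (n * (2 * (E * (1 + |z|)))))) := by
        gcongr
        exact h3.trans (by gcongr; exact hQ.trans (by gcongr))
      -- The choice `K = 2m + 5`: `n⁴` from the crude bound, `n²ᵐ` from `(1 + ε)²`, and one `n` from
      -- the degree term. The constant is `256 · 3 · 7 · 2`.
      _ = 10752 * (c ^ 2 * m ^ 2 * (γ + 1) ^ 2 * L ^ 2) *
          (0 + E * ((n : ℝ) ^ K * (1 + |z|) * 1)) := by
        rw [hK]
        ring
      _ ≤ 10752 * (c ^ 2 * m ^ 2 * (γ + 1) ^ 2 * L ^ 2) *
          (0 + E * ((n : ℝ) ^ K * (1 + |z|) * badBound B K G z)) := by gcongr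
      _ ≤ 10752 * (c ^ 2 * m ^ 2 * (γ + 1) ^ 2 * L ^ 2) * (edgeDensity G * n
        + E * ((2 + (n : ℝ) ^ K * B.indicator 1 G) * W)) := by
        have hbd' : (n : ℝ) ^ K * (1 + |z|) * badBound B K G z
            ≤ (2 + (n : ℝ) ^ K * B.indicator 1 G) * W := by
          refine hbd.trans ?_
          gcongr
          norm_num
        gcongr
      _ = _ := by ring

end Pointwise
-- Integrating: bias–noise decomposition of the squared error.
section Main

/-- Expanding the square, the cross term vanishes because the Student noise is independent and
centred. -/
theorem integrable_and_integral_sq_sub_mul_student {Ω : Type*} [MeasurableSpace Ω]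
    (P : Measure Ω) [IsProbabilityMeasure P] {A S : Ω → ℝ} (hA : Measurable A) (hS : Measurable S)
    (hA2 : Integrable (fun x => A x ^ 2) P) (hS2 : Integrable (fun x => S x ^ 2) P) :
    Integrable (fun y : Ω × ℝ => (A y.1 - S y.1 * y.2) ^ 2) (P.prod studentT3Measure) ∧
      ∫ y, (A y.1 - S y.1 * y.2) ^ 2 ∂(P.prod studentT3Measure)
        = ∫ x, A x ^ 2 ∂P + (∫ t, t ^ 2 ∂studentT3Measure) * ∫ x, S x ^ 2 ∂P := by
  have hAS : Integrable (fun x => A x * S x) P := by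
    refine (hA2.add hS2).mono' (hA.mul hS).aestronglyMeasurable
      (Filter.Eventually.of_forall fun x => ?_)
    rw [Real.norm_eq_abs, abs_le, Pi.add_apply]
    constructor <;> nlinarith [sq_nonneg (A x - S x), sq_nonneg (A x + S x)]
  have i1 : Integrable (fun y : Ω × ℝ => A y.1 ^ 2 * (fun _ : ℝ => (1 : ℝ)) y.2)
      (P.prod studentT3Measure) := hA2.mul_prod (integrable_const (1 : ℝ))
  have i2 : Integrable (fun y : Ω × ℝ => A y.1 * S y.1 * y.2)
      (P.prod studentT3Measure) := hAS.mul_prod integrable_id_studentT3Measure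
  have i3 : Integrable (fun y : Ω × ℝ => S y.1 ^ 2 * y.2 ^ 2)
      (P.prod studentT3Measure) := hS2.mul_prod integrable_sq_studentT3Measure
  have e : (fun y : Ω × ℝ => (A y.1 - S y.1 * y.2) ^ 2) = fun y =>
      A y.1 ^ 2 * (fun _ : ℝ => (1 : ℝ)) y.2 - 2 * (A y.1 * S y.1 * y.2)
        + S y.1 ^ 2 * y.2 ^ 2 := by
    ext y
    ring
  have i2' := i2.const_mul 2
  rw [e]
  refine ⟨(i1.sub i2').add i3, ?_⟩
  refine (integral_add (i1.sub i2') i3).trans ?_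
  rw [integral_sub' i1 i2', integral_const_mul]
  have h1 := integral_prod_mul (μ := P) (ν := studentT3Measure) (fun x => A x ^ 2)
    (fun _ : ℝ => (1 : ℝ))
  have h2 := integral_prod_mul (μ := P) (ν := studentT3Measure) (fun x => A x * S x)
    (fun t : ℝ => t)
  have h3 := integral_prod_mul (μ := P) (ν := studentT3Measure) (fun x => S x ^ 2)
    (fun t : ℝ => t ^ 2)
  rw [h1, h2, h3, integral_id_studentT3Measure]
  simp
  ring

variable {n : ℕ}

/-- The law of the graph and of the Laplace noise. -/
noncomputable def graphLaplaceLaw (n : ℕ) (p : unitInterval) : Measure (SimpleGraph (Fin n) × ℝ) :=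
  (SimpleGraph.binomialRandom (Fin n) p).prod laplaceMeasure

instance (p : unitInterval) : IsProbabilityMeasure (graphLaplaceLaw n p) := by
  unfold graphLaplaceLaw
  infer_instance

/-- The second moment of the Student noise. -/
noncomputable def studentSecondMoment : ℝ := ∫ t, t ^ 2 ∂studentT3Measure

theorem integrable_and_integral_squaredError (hn : 2 ≤ n) (c : ℝ) {ε : ℝ} (hε : 0 < ε)
    (α : ℝ) (p : unitInterval)
    (hs : Integrable (fun x : SimpleGraph (Fin n) × ℝ =>
      noiseScale c x.1 ε (kTilde x.1 ε α x.2) ^ 2) (graphLaplaceLaw n p)) :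
    Integrable (squaredError c ε α p) (jointLaw n p) ∧
      ∫ ω, squaredError c ε α p ω ∂(jointLaw n p)
        = ∫ x, ((p : ℝ) - totalVal x.1 ε (kTilde x.1 ε α x.2) / n.choose 2) ^ 2
            ∂(graphLaplaceLaw n p)
          + studentSecondMoment * ((1 / (ε * n.choose 2)) ^ 2 *
            ∫ x, noiseScale c x.1 ε (kTilde x.1 ε α x.2) ^ 2 ∂(graphLaplaceLaw n p)) := by
  have hn0 : 0 < n := by omega
  have hA : Measurable fun x : SimpleGraph (Fin n) × ℝ =>
      (p : ℝ) - totalVal x.1 ε (kTilde x.1 ε α x.2) / n.choose 2 :=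
    measurable_const.sub ((measurable_totalVal_kTilde hn0 ε α).div_const _)
  have hS : Measurable fun x : SimpleGraph (Fin n) × ℝ =>
      1 / (ε * n.choose 2) * noiseScale c x.1 ε (kTilde x.1 ε α x.2) :=
    (measurable_noiseScale_kTilde hn0 c ε α).const_mul _
  have hA2 : Integrable (fun x : SimpleGraph (Fin n) × ℝ =>
      ((p : ℝ) - totalVal x.1 ε (kTilde x.1 ε α x.2) / n.choose 2) ^ 2) (graphLaplaceLaw n p) := by
    refine Integrable.of_bound (C := 1) (hA.pow_const 2).aestronglyMeasurable
      (Filter.Eventually.of_forall fun x => ?_)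
    obtain ⟨h1, h2⟩ := totalVal_div_mem x.1 hε (kTilde_nonneg x.1 ε α x.2)
    have h5 := p.2.1
    have h6 := p.2.2
    rw [Real.norm_eq_abs, abs_of_nonneg (sq_nonneg _)]
    nlinarith
  have hS2 : Integrable (fun x : SimpleGraph (Fin n) × ℝ =>
      (1 / (ε * n.choose 2) * noiseScale c x.1 ε (kTilde x.1 ε α x.2)) ^ 2)
      (graphLaplaceLaw n p) := by
    simp_rw [mul_pow]
    exact hs.const_mul _
  obtain ⟨h1, h2⟩ := integrable_and_integral_sq_sub_mul_student (graphLaplaceLaw n p) hA hS hA2 hS2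
  have hmp := measurePreserving_prodAssoc (SimpleGraph.binomialRandom (Fin n) p) laplaceMeasure
    studentT3Measure
  have e : (fun y : (SimpleGraph (Fin n) × ℝ) × ℝ =>
      ((p : ℝ) - totalVal y.1.1 ε (kTilde y.1.1 ε α y.1.2) / n.choose 2
        - 1 / (ε * n.choose 2) * noiseScale c y.1.1 ε (kTilde y.1.1 ε α y.1.2) * y.2) ^ 2)
      = squaredError c ε α p ∘ MeasurableEquiv.prodAssoc := by
    ext y
    have := choose_two_pos hn
    simp only [squaredError, erdosRenyiEstimator, concentratedDegreeEstimator, Function.comp_apply,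
      MeasurableEquiv.prodAssoc, MeasurableEquiv.coe_mk, Equiv.prodAssoc_apply]
    congr 1
    field_simp
    ring
  constructor
  · rw [e] at h1
    exact (hmp.integrable_comp_emb MeasurableEquiv.prodAssoc.measurableEmbedding).1 h1
  · have h3 := hmp.integral_comp MeasurableEquiv.prodAssoc.measurableEmbedding
      (squaredError c ε α p)
    rw [jointLaw, ← h3]
    refine (congrArg (fun f => ∫ y, f y ∂((graphLaplaceLaw n p).prod studentT3Measure))
      e.symm).trans (h2.trans ?_)
    simp_rw [mul_pow, integral_const_mul]
    rfl

/-- The exponential moment of the Laplace noise used to dominate the noise scale. -/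
noncomputable def laplaceMoment : ℝ := ∫ z, 4 * Real.exp (3 / 4 * |z|) ∂laplaceMeasure

theorem laplaceMoment_nonneg : 0 ≤ laplaceMoment := integral_nonneg fun z => by positivity

theorem integrable_laplaceMoment :
    Integrable (fun z => 4 * Real.exp (3 / 4 * |z|)) laplaceMeasure :=
  (integrable_exp_abs_laplaceMeasure (by norm_num)).const_mul 4

theorem integral_indicator_one_eq (p : unitInterval) (B : Set (SimpleGraph (Fin n))) :
    ∫ G, B.indicator (1 : SimpleGraph (Fin n) → ℝ) G ∂(SimpleGraph.binomialRandom (Fin n) p)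
      = (SimpleGraph.binomialRandom (Fin n) p).real B :=
  integral_indicator_one B.toFinite.measurableSet

theorem integrable_and_integral_noiseScale_sq_le (hn : 2 ≤ n) {B : Set (SimpleGraph (Fin n))}
    {K m γ : ℕ} (hm : 0 < m) (hK : K = 2 * m + 5) (hγ : 2 * K ≤ γ) {c ε : ℝ} (hc : 0 < c)
    (hε : 0 < ε) (hεm : ε ≤ m * (n : ℝ) ^ m) (hB : ∀ G ∉ B, Concentrated G ε m γ)
    (p : unitInterval) {C₁ : ℝ}
    (hBp : (SimpleGraph.binomialRandom (Fin n) p).real B ≤ C₁ * ((n : ℝ) ^ K)⁻¹) :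
    Integrable (fun x : SimpleGraph (Fin n) × ℝ =>
        noiseScale c x.1 ε (kTilde x.1 ε (1 / (n : ℝ) ^ γ) x.2) ^ 2) (graphLaplaceLaw n p) ∧
      ∫ x, noiseScale c x.1 ε (kTilde x.1 ε (1 / (n : ℝ) ^ γ) x.2) ^ 2 ∂(graphLaplaceLaw n p)
        ≤ 10752 * c ^ 2 * m ^ 2 * (γ + 1) ^ 2 * Real.log n ^ 2 *
          (p * n + (1 + 1 / ε ^ 2) * ((2 + C₁) * laplaceMoment)) := by
  have hn0 : (0 : ℝ) < n := by positivity
  set D : ℝ := 10752 * c ^ 2 * m ^ 2 * (γ + 1) ^ 2 * Real.log n ^ 2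
  have hD : 0 ≤ D := by positivity
  have i1 : Integrable (fun x : SimpleGraph (Fin n) × ℝ =>
      edgeDensity x.1 * n * (fun _ : ℝ => (1 : ℝ)) x.2) (graphLaplaceLaw n p) :=
    Integrable.mul_prod (f := fun G => edgeDensity G * n) (g := fun _ : ℝ => (1 : ℝ))
      Integrable.of_finite (integrable_const _)
  have i2 : Integrable (fun x : SimpleGraph (Fin n) × ℝ =>
      (2 + (n : ℝ) ^ K * B.indicator 1 x.1) * (4 * Real.exp (3 / 4 * |x.2|)))
      (graphLaplaceLaw n p) :=
    Integrable.mul_prod (f := fun G => 2 + (n : ℝ) ^ K * B.indicator 1 G)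
      (g := fun z => 4 * Real.exp (3 / 4 * |z|)) Integrable.of_finite integrable_laplaceMoment
  have i3 := (i1.add (i2.const_mul (1 + 1 / ε ^ 2))).const_mul D
  have hle : ∀ x : SimpleGraph (Fin n) × ℝ,
      noiseScale c x.1 ε (kTilde x.1 ε (1 / (n : ℝ) ^ γ) x.2) ^ 2 ≤
      D * (edgeDensity x.1 * n * (fun _ : ℝ => (1 : ℝ)) x.2 + (1 + 1 / ε ^ 2) *
        ((2 + (n : ℝ) ^ K * B.indicator 1 x.1) * (4 * Real.exp (3 / 4 * |x.2|)))) := by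
    intro x
    simp only [mul_one]
    exact noiseScale_sq_le hn hm hK hγ hc hε hεm hB x.1 x.2
  have i0 : Integrable (fun x : SimpleGraph (Fin n) × ℝ =>
      noiseScale c x.1 ε (kTilde x.1 ε (1 / (n : ℝ) ^ γ) x.2) ^ 2) (graphLaplaceLaw n p) := by
    refine i3.mono' ((measurable_noiseScale_kTilde (by omega) c ε _).pow_const 2).aestronglyMeasurable
      (Filter.Eventually.of_forall fun x => ?_)
    rw [Real.norm_eq_abs, abs_of_nonneg (sq_nonneg _)]
    exact hle x
  refine ⟨i0, (integral_mono i0 i3 hle).trans ?_⟩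
  have e1 := integral_prod_mul (μ := SimpleGraph.binomialRandom (Fin n) p) (ν := laplaceMeasure)
    (fun G => edgeDensity G * n) (fun _ : ℝ => (1 : ℝ))
  have e2 := integral_prod_mul (μ := SimpleGraph.binomialRandom (Fin n) p) (ν := laplaceMeasure)
    (fun G => 2 + (n : ℝ) ^ K * B.indicator 1 G) (fun z => 4 * Real.exp (3 / 4 * |z|))
  have e3 : ∫ G, (2 + (n : ℝ) ^ K * B.indicator 1 G) ∂(SimpleGraph.binomialRandom (Fin n) p)
      ≤ 2 + C₁ := by
    rw [integral_add Integrable.of_finite Integrable.of_finite, integral_const_mul,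
      integral_indicator_one_eq, integral_const, probReal_univ, one_smul]
    have := mul_le_mul_of_nonneg_left hBp (show 0 ≤ (n : ℝ) ^ K by positivity)
    rw [mul_comm C₁, mul_inv_cancel_left₀ (by positivity)] at this
    linarith
  rw [integral_const_mul]
  simp only [Pi.add_apply]
  rw [integral_add i1 (i2.const_mul _), integral_const_mul]
  unfold graphLaplaceLaw
  rw [e1, e2, integral_mul_const, integral_edgeDensity hn, integral_const, probReal_univ, one_smul,
    mul_one]
  have := laplaceMoment_nonneg
  change D * (p * n + (1 + 1 / ε ^ 2) * (_ * laplaceMoment)) ≤ _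
  gcongr

theorem abs_integral_sub_variance_le (hn : 2 ≤ n) {B : Set (SimpleGraph (Fin n))}
    {K m γ : ℕ} (hm : 0 < m) (hγ : 2 * K ≤ γ) {ε : ℝ}
    (hε : 0 < ε) (hB : ∀ G ∉ B, Concentrated G ε m γ) (p : unitInterval) {C₁ : ℝ}
    (hBp : (SimpleGraph.binomialRandom (Fin n) p).real B ≤ C₁ * ((n : ℝ) ^ K)⁻¹) :
    |∫ x, ((p : ℝ) - totalVal x.1 ε (kTilde x.1 ε (1 / (n : ℝ) ^ γ) x.2) / n.choose 2) ^ 2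
          ∂(graphLaplaceLaw n p) - p * (1 - p) / n.choose 2|
      ≤ (C₁ + laplaceMoment) * ((n : ℝ) ^ K)⁻¹ := by
  have hA : Measurable fun x : SimpleGraph (Fin n) × ℝ =>
      (p : ℝ) - totalVal x.1 ε (kTilde x.1 ε (1 / (n : ℝ) ^ γ) x.2) / n.choose 2 :=
    measurable_const.sub ((measurable_totalVal_kTilde (by omega) ε _).div_const _)
  have hA2 : Integrable (fun x : SimpleGraph (Fin n) × ℝ =>
      ((p : ℝ) - totalVal x.1 ε (kTilde x.1 ε (1 / (n : ℝ) ^ γ) x.2) / n.choose 2) ^ 2)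
      (graphLaplaceLaw n p) := by
    refine Integrable.of_bound (C := 1) (hA.pow_const 2).aestronglyMeasurable
      (Filter.Eventually.of_forall fun x => ?_)
    obtain ⟨h1, h2⟩ := totalVal_div_mem x.1 hε (kTilde_nonneg x.1 ε (1 / (n : ℝ) ^ γ) x.2)
    have h5 := p.2.1
    have h6 := p.2.2
    rw [Real.norm_eq_abs, abs_of_nonneg (sq_nonneg _)]
    nlinarith
  have hV : Integrable (fun x : SimpleGraph (Fin n) × ℝ =>
      ((p : ℝ) - edgeDensity x.1) ^ 2) (graphLaplaceLaw n p) :=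
    Integrable.comp_fst (f := fun G => ((p : ℝ) - edgeDensity G) ^ 2) Integrable.of_finite _
  have hVe : ∫ x : SimpleGraph (Fin n) × ℝ, ((p : ℝ) - edgeDensity x.1) ^ 2 ∂(graphLaplaceLaw n p)
      = p * (1 - p) / n.choose 2 := by
    rw [← integral_sq_sub_edgeDensity hn p, graphLaplaceLaw,
      integral_fun_fst (fun G => ((p : ℝ) - edgeDensity G) ^ 2), probReal_univ, one_smul]
  have hexp : Integrable (fun z : ℝ => Real.exp (|z| / 2)) laplaceMeasure := by
    have := integrable_exp_abs_laplaceMeasure (b := 1 / 2) (by norm_num)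
    exact this.congr (Filter.Eventually.of_forall fun z => by simp only; ring_nf)
  have j1 : Integrable (fun x : SimpleGraph (Fin n) × ℝ =>
      B.indicator (1 : SimpleGraph (Fin n) → ℝ) x.1) (graphLaplaceLaw n p) :=
    Integrable.comp_fst (f := B.indicator (1 : SimpleGraph (Fin n) → ℝ)) Integrable.of_finite _
  have j2 : Integrable (fun x : SimpleGraph (Fin n) × ℝ =>
      ((n : ℝ) ^ K)⁻¹ * Real.exp (|x.2| / 2)) (graphLaplaceLaw n p) :=
    (Integrable.comp_snd (f := fun z : ℝ => Real.exp (|z| / 2)) hexp _).const_mul _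
  have hbd : ∫ x : SimpleGraph (Fin n) × ℝ, badBound B K x.1 x.2 ∂(graphLaplaceLaw n p)
      ≤ (C₁ + laplaceMoment) * ((n : ℝ) ^ K)⁻¹ := by
    unfold badBound
    rw [integral_add j1 j2, integral_const_mul, graphLaplaceLaw,
      integral_fun_fst (B.indicator (1 : SimpleGraph (Fin n) → ℝ)),
      integral_fun_snd (fun z : ℝ => Real.exp (|z| / 2)), probReal_univ, probReal_univ, one_smul,
      one_smul, integral_indicator_one_eq]
    have h1 : ∫ z, Real.exp (|z| / 2) ∂laplaceMeasure ≤ laplaceMoment := by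
      refine integral_mono hexp integrable_laplaceMoment fun z => ?_
      have h2 : Real.exp (|z| / 2) ≤ Real.exp (3 / 4 * |z|) := by
        gcongr
        linarith [abs_nonneg z]
      have h3 := Real.exp_pos (3 / 4 * |z|)
      change Real.exp (|z| / 2) ≤ 4 * Real.exp (3 / 4 * |z|)
      linarith
    have h2 := mul_le_mul_of_nonneg_left h1 (show 0 ≤ ((n : ℝ) ^ K)⁻¹ by positivity)
    linarith
  rw [← hVe, ← integral_sub hA2 hV]
  refine (abs_integral_le_integral_abs).trans ((integral_mono (hA2.sub hV).abs (j1.add j2)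
    fun x => ?_).trans hbd)
  exact abs_sq_sub_sq_le_badBound hn hm hγ hε hB p x.1 x.2

end Main
-- Comparison with the stated rate.
section Assembly

/-- The failure probability is below the rate because `ε` is polynomially bounded and the maximum is
at least `1/n`; `log n ≥ 0.69` makes `3 (log n)² ≥ 1`. -/
theorem inv_pow_le_rate {n m K : ℕ} (hn : 2 ≤ n) (hK : K = 2 * m + 5) {ε : ℝ} (hε : 0 < ε)
    (hεm : ε ≤ m * (n : ℝ) ^ m) (p : ℝ) :
    ((n : ℝ) ^ K)⁻¹ ≤ 3 * (m : ℝ) ^ 2 * Real.log n ^ 2 *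
      (max p (1 / n) / (ε ^ 2 * (n : ℝ) ^ 3)) := by
  have hn' : (2 : ℝ) ≤ n := by exact_mod_cast hn
  have hn0 : (0 : ℝ) < n := by linarith
  have hL := log_ge_of_two_le hn
  have hL3 : 1 ≤ 3 * Real.log n ^ 2 := by nlinarith
  have h1 : ((n : ℝ) ^ K)⁻¹ ≤ m ^ 2 * (1 / n / (ε ^ 2 * (n : ℝ) ^ 3)) := by
    rw [div_div, ← mul_div_assoc, mul_one, inv_eq_one_div, div_le_div_iff₀ (by positivity)
      (by positivity), one_mul]
    calc (n : ℝ) * (ε ^ 2 * n ^ 3) ≤ n * ((m * (n : ℝ) ^ m) ^ 2 * n ^ 3) := by gcongr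
      _ = m ^ 2 * (n : ℝ) ^ (2 * m + 4) * 1 := by ring
      _ ≤ m ^ 2 * (n : ℝ) ^ (2 * m + 4) * n := by gcongr; linarith
      _ = _ := by rw [hK]; ring
  calc _ ≤ 1 * (m ^ 2 * (1 / n / (ε ^ 2 * (n : ℝ) ^ 3))) := by linarith
    _ ≤ 3 * Real.log n ^ 2 * (m ^ 2 * (max p (1 / n) / (ε ^ 2 * (n : ℝ) ^ 3))) := by
      gcongr
      exact le_max_right _ _
    _ = _ := by ring

/-- The maximum with `1/n` absorbs the constant term, since `n · max p (1/n) ≥ 1`; the `16` comes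
from `N ≥ n²/4`. -/
theorem noise_rate_le {n : ℕ} (hn : 2 ≤ n) {ε : ℝ} (hε : 0 < ε) (p : ℝ) {x : ℝ} (hx : 0 ≤ x) :
    (1 / (ε * n.choose 2)) ^ 2 * (p * n + (1 + 1 / ε ^ 2) * x) ≤
      16 * (1 + x) * (max p (1 / n) / (ε ^ 2 * (n : ℝ) ^ 3) + 1 / (ε ^ 4 * (n : ℝ) ^ 4)) := by
  have hn' : (2 : ℝ) ≤ n := by exact_mod_cast hn
  have hn0 : (0 : ℝ) < n := by linarith
  have hN : (n : ℝ) ^ 2 / 4 ≤ n.choose 2 := by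
    rw [choose_two_eq]
    nlinarith
  set q := max p (1 / n)
  have hq1 : p ≤ q := le_max_left _ _
  have hq2 : 1 ≤ q * n := by
    rw [← div_le_iff₀ hn0]
    exact le_max_right _ _
  have hq : 0 < q := lt_of_lt_of_le (by positivity : (0 : ℝ) < 1 / n) (le_max_right _ _)
  have h1 : p * n + (1 + 1 / ε ^ 2) * x ≤ (1 + x) * (q * n + 1 / ε ^ 2) := by
    have h2 : p * n ≤ q * n := by gcongr
    have h3 : 1 * x ≤ q * n * x := by gcongr
    have h4 : 0 < 1 / ε ^ 2 := by positivity
    nlinarith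
  calc _ ≤ (1 / (ε * n.choose 2)) ^ 2 * ((1 + x) * (q * n + 1 / ε ^ 2)) := by gcongr
    _ ≤ (1 / (ε * ((n : ℝ) ^ 2 / 4))) ^ 2 * ((1 + x) * (q * n + 1 / ε ^ 2)) := by
        have : 0 ≤ (1 + x) * (q * n + 1 / ε ^ 2) := by positivity
        gcongr
    _ = _ := by
      field_simp
      ring

theorem exists_rate_bound {m : ℕ} (hm : 0 < m) {γ K : ℕ} (hK : K = 2 * m + 5)
    (hγ : γ = 64 * m * (K + 1) ^ 2) {c : ℝ} (hc : 0 < c) :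
    ∃ C : ℝ, 0 < C ∧ ∀ (n : ℕ) (p : unitInterval) (ε : ℝ), 2 ≤ n → 0 < ε →
      (ε ≤ m ∨ Real.log n / n ≤ (p : ℝ)) → ε ≤ m * (n : ℝ) ^ m →
        Integrable (squaredError c ε (1 / (n : ℝ) ^ γ) p) (jointLaw n p) ∧
          |(∫ ω, squaredError c ε (1 / (n : ℝ) ^ γ) p ω ∂(jointLaw n p))
              - (p : ℝ) * (1 - (p : ℝ)) / (n.choose 2 : ℝ)|
            ≤ C * Real.log n ^ 2 *
                (max (p : ℝ) (1 / n) / (ε ^ 2 * (n : ℝ) ^ 3) + 1 / (ε ^ 4 * (n : ℝ) ^ 4)) := by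
  obtain ⟨C₁, hC₁, h⟩ := exists_bad_set hm K hγ
  have hγ2 : 2 * K ≤ γ := by
    rw [hγ]
    nlinarith [Nat.mul_le_mul_right ((K + 1) ^ 2) hm]
  have hw := laplaceMoment_nonneg
  have hv : 0 ≤ studentSecondMoment := integral_nonneg fun t => sq_nonneg t
  set w := laplaceMoment
  set V := studentSecondMoment
  set D : ℝ := 10752 * c ^ 2 * m ^ 2 * (γ + 1) ^ 2 with hD
  have hD0 : 0 ≤ D := by positivity
  have hm0 : (0 : ℝ) < m := by exact_mod_cast hm
  refine ⟨(C₁ + w) * (3 * (m : ℝ) ^ 2) + V * D * (16 * (1 + (2 + C₁) * w)), by positivity,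
    fun n p ε hn hε hεp hεm => ?_⟩
  obtain ⟨B, hBp, hB⟩ := h n p ε hn hε hεp
  obtain ⟨i, hs⟩ := integrable_and_integral_noiseScale_sq_le hn hm hK hγ2 hc hε hεm hB p hBp
  obtain ⟨i', e⟩ := integrable_and_integral_squaredError hn c hε (1 / (n : ℝ) ^ γ) p i
  refine ⟨i', ?_⟩
  rw [e]
  have hb := abs_integral_sub_variance_le hn hm hγ2 hε hB p hBp
  set I := ∫ x, noiseScale c x.1 ε (kTilde x.1 ε (1 / (n : ℝ) ^ γ) x.2) ^ 2 ∂(graphLaplaceLaw n p)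
    with hI
  have hI0 : 0 ≤ I := integral_nonneg fun x => sq_nonneg _
  set R := max (p : ℝ) (1 / n) / (ε ^ 2 * (n : ℝ) ^ 3) with hR
  have hr := inv_pow_le_rate hn hK hε hεm (p : ℝ)
  have hnr := noise_rate_le hn hε (p : ℝ) (x := (2 + C₁) * w) (by positivity)
  rw [← hR] at hr hnr
  have hR4 : 0 ≤ 1 / (ε ^ 4 * (n : ℝ) ^ 4) := by positivity
  have hnoise : V * ((1 / (ε * n.choose 2)) ^ 2 * I) ≤
      V * D * (16 * (1 + (2 + C₁) * w)) * Real.log n ^ 2 * (R + 1 / (ε ^ 4 * (n : ℝ) ^ 4)) := by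
    calc _ ≤ V * ((1 / (ε * n.choose 2)) ^ 2 * (D * Real.log n ^ 2 *
          (p * n + (1 + 1 / ε ^ 2) * ((2 + C₁) * w)))) := by gcongr
      _ = V * D * Real.log n ^ 2 * ((1 / (ε * n.choose 2)) ^ 2 *
          (p * n + (1 + 1 / ε ^ 2) * ((2 + C₁) * w))) := by ring
      _ ≤ V * D * Real.log n ^ 2 * (16 * (1 + (2 + C₁) * w) *
          (R + 1 / (ε ^ 4 * (n : ℝ) ^ 4))) := by gcongr
      _ = _ := by ring
  have hbias : (C₁ + w) * ((n : ℝ) ^ K)⁻¹ ≤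
      (C₁ + w) * (3 * (m : ℝ) ^ 2) * Real.log n ^ 2 * (R + 1 / (ε ^ 4 * (n : ℝ) ^ 4)) := by
    calc _ ≤ (C₁ + w) * (3 * (m : ℝ) ^ 2 * Real.log n ^ 2 *
          (R + 1 / (ε ^ 4 * (n : ℝ) ^ 4))) := by
          gcongr
          refine hr.trans ?_
          gcongr
          linarith
      _ = _ := by ring
  have hV0 : 0 ≤ V * ((1 / (ε * n.choose 2)) ^ 2 * I) := by positivity
  rw [add_sub_right_comm]
  refine (abs_add_le _ _).trans ?_
  rw [abs_of_nonneg hV0, add_mul, add_mul]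
  exact add_le_add (hb.trans hbias) hnoise

end Assembly
end NodePrivate

theorem mainTheorem2 (M : ℝ) :
    ∃ γ a : ℕ, 0 < γ ∧ ∀ c : ℝ, 0 < c → ∃ C : ℝ, 0 < C ∧
      ∀ (n : ℕ) (p : unitInterval) (ε : ℝ), 2 ≤ n → (p : ℝ) ≤ 1 / 2 → 0 < ε →
        (ε ≤ M ∨ (Real.log n / n ≤ (p : ℝ) ∧ ε ≤ (n : ℝ) ^ M)) →
        Integrable (NodePrivate.squaredError c ε (1 / (n : ℝ) ^ γ) p)
            (NodePrivate.jointLaw n p) ∧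
          |(∫ ω, NodePrivate.squaredError c ε (1 / (n : ℝ) ^ γ) p ω
                ∂(NodePrivate.jointLaw n p))
              - (p : ℝ) * (1 - (p : ℝ)) / (n.choose 2 : ℝ)|
            ≤ C * Real.log n ^ a *
                (max (p : ℝ) (1 / n) / (ε ^ 2 * (n : ℝ) ^ 3) + 1 / (ε ^ 4 * (n : ℝ) ^ 4)) := by
  obtain ⟨m, hm, hMm⟩ : ∃ m : ℕ, 0 < m ∧ M ≤ m :=
    ⟨⌈M⌉₊ + 1, Nat.succ_pos _, by push_cast; linarith [Nat.le_ceil M]⟩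
  -- This is `γ = 64 m (K + 1)²` with `K = 2m + 5`; the two logarithms come from the bound on
  -- `kTilde²`.
  refine ⟨64 * m * (2 * m + 5 + 1) ^ 2, 2, by positivity, fun c hc => ?_⟩
  obtain ⟨C, hC, h⟩ := NodePrivate.exists_rate_bound hm rfl rfl hc
  refine ⟨C, hC, fun n p ε hn _ hε hyp => h n p ε hn hε ?_ ?_⟩
  · exact hyp.imp (fun h => h.trans hMm) And.left
  · have hn1 : (1 : ℝ) ≤ n := by exact_mod_cast (by omega : 1 ≤ n)
    have hm1 : (1 : ℝ) ≤ m := by exact_mod_cast hm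
    have hnm : (1 : ℝ) ≤ (n : ℝ) ^ m := one_le_pow₀ hn1
    rcases hyp with h1 | ⟨_, h1⟩
    · exact (h1.trans hMm).trans (le_mul_of_one_le_right (by linarith) hnm)
    · refine h1.trans ((Real.rpow_le_rpow_of_exponent_le hn1 hMm).trans ?_)
      rw [Real.rpow_natCast]
      exact le_mul_of_one_le_left (by linarith) hm1
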